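/- Let $d\ge 3$ be an integer, $\gamma\ge 1$, and let $\bar\rho$ be the density of a liquid Lane–Emden star of radius $R\in(0,\infty)$ in $\mathbb R^d$: $\bar\rho$ is continuous and positive on $[0,R]$, $\bar\rho(R)=1$, $\bar\rho^\gamma$ is differentiable on $(0,R)$, and $$\frac1{\bar\rho}\,\partial_y\bar\rho^\gamma+\frac{4\pi}{y^{d-1}}\int_0^y s^{d-1}\bar\rho(s)\,ds=0\qquad(0<y<R).$$ Put $$L\chi=-\gamma\,\partial_y\big(\bar\rho^\gamma y^{d+1}\partial_y\chi\big)+(2(d-1)-d\gamma)\,y^d\chi\,\partial_y\bar\rho^\gamma .$$ Let $H^1_r$ be the space of spherically symmetric functions in $H^1(B_R)$, $B_R\subset\mathbb R^{d+2}$ the ball of radius $R$ centred at the origin, regarded as functions of the radius $y\in(0,R]$, each represented by its representative that is continuous on $(0,R]$ (so that $\chi(R)$ is the trace of $\chi$). For $\chi\in H^1_r$ write $\|\chi\|^2_{y^{d+1}\bar\rho}=\int_0^R y^{d+1}\bar\rho\,\chi^2\,dy$ and let $\langle L\chi,\chi\rangle$ denote the quadratic form $$\langle L\chi,\chi\rangle=\int_0^R\Big(\gamma\bar\rho^\gamma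 y^{d+1}(\partial_y\chi)^2+(2(d-1)-d\gamma)\,y^d\chi^2\,\partial_y\bar\rho^\gamma\Big)dy+d\gamma R^d\chi(R)^2 ,$$ which is what $\int_0^R\chi\,L\chi\,dy$ becomes after integration by parts when $\chi\in C^2([0,R])$ satisfies the Robin condition $d\chi(R)+R\chi'(R)=0$. A real number $\mu$ is called an eigenvalue of $L$ if there is a nonzero $\chi\in H^1_r$ (an eigenfunction), of class $C^2$ on $(0,R]$, with $L\chi=\mu\,y^{d+1}\bar\rho\,\chi$ on $(0,R)$ and $d\chi(R)+R\chi'(R)=0$. Then $$\mu_*:=\inf\{\langle L\chi,\chi\rangle:\ \chi\in H^1_r,\ \|\chi\|_{y^{d+1}\bar\rho}=1\}$$ is finite and is equal to $\inf\{\mu:\ \mu\text{ is an eigenvalue of }L\}$. Both infima are attained: there is $\chi_*\in H^1_r$ with $\|\chi_*\|_{y^{d+1}\bar\rho}=1$ and $\langle L\chi_*,\chi_*\rangle=\mu_*$ which is an eigenfunction of $L$ with eigenvalue $\mu_*$; in particular $\mu_*$ is the smallest eigenvalue of $L$. Consequently, if $\langle L\chi,\chi\rangle<0$ for some $\chi\in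 H^1_r$, then $\mu_*<0$ and $\zeta(y,t)=e^{\sqrt{-\mu_*}\,t}\chi_*(y)$ is a growing mode, i.e. it solves the linearised momentum equation $$y\,\partial_t^2\zeta+\frac{2(d-1)}{\bar\rho}\,\zeta\,\partial_y\bar\rho^\gamma-\frac{\gamma}{\bar\rho}\,\partial_y\big(\bar\rho^\gamma(d\zeta+y\,\partial_y\zeta)\big)=0\quad(0<y<R),\qquad d\zeta(R,t)+R\,\partial_y\zeta(R,t)=0 .$$ -/

import Mathlib

open MeasureTheory Set

noncomputable section

namespace LaneEmden

/-- `ρ` is the density profile, on `[0, R]`, of a liquid Lane–Emden star of radius `R` in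
dimension `d` with adiabatic exponent `γ`: it is continuous and positive on `[0, R]`, solves the
steady state momentum equation
`(1/ρ) ∂_y ρ^γ + (4π / y^(d-1)) ∫₀^y s^(d-1) ρ(s) ds = 0` on `(0, R)`, and equals `1` on the
boundary (vanishing of the pressure `ρ^γ - 1`). -/
structure IsLiquidStar (d : ℕ) (γ R : ℝ) (ρ : ℝ → ℝ) : Prop where
  radius_pos : 0 < R
  continuousOn : ContinuousOn ρ (Icc 0 R)
  pos : ∀ y ∈ Icc 0 R, 0 < ρ y
  differentiableAt : ∀ y ∈ Ioo 0 R, DifferentiableAt ℝ (fun s => ρ s ^ γ) y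
  momentum : ∀ y ∈ Ioo 0 R,
    1 / ρ y * deriv (fun s => ρ s ^ γ) y
      + 4 * Real.pi / y ^ (d - 1) * ∫ s in (0 : ℝ)..y, s ^ (d - 1) * ρ s = 0
  boundary : ρ R = 1

/-- The open ball `B_R` of `ℝⁿ`, centred at the origin. -/
abbrev B (n : ℕ) (R : ℝ) : Set (EuclideanSpace ℝ (Fin n)) := Metric.ball 0 R

/-- `g` is the weak gradient of `u` on `B_R ⊆ ℝⁿ`. -/
def IsWeakGradient (n : ℕ) (R : ℝ) (u : EuclideanSpace ℝ (Fin n) → ℝ)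
    (g : EuclideanSpace ℝ (Fin n) → EuclideanSpace ℝ (Fin n)) : Prop :=
  ∀ φ : EuclideanSpace ℝ (Fin n) → ℝ, ContDiff ℝ (⊤ : ℕ∞) φ → HasCompactSupport φ →
    tsupport φ ⊆ B n R → ∀ v : EuclideanSpace ℝ (Fin n),
      ∫ x in B n R, u x * fderiv ℝ φ x v = -∫ x in B n R, inner ℝ (g x) v * φ x

/-- `u` belongs to the Sobolev space `H¹(B_R)`, `B_R ⊆ ℝⁿ`. -/
def MemH1 (n : ℕ) (R : ℝ) (u : EuclideanSpace ℝ (Fin n) → ℝ) : Prop :=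
  MemLp u 2 (volume.restrict (B n R)) ∧
    ∃ g : EuclideanSpace ℝ (Fin n) → EuclideanSpace ℝ (Fin n),
      MemLp g 2 (volume.restrict (B n R)) ∧ IsWeakGradient n R u g

/-- `χ` is (the profile, as a function of the radial variable `y ∈ (0, R]`, of) an element of
`H¹_r(B_R)`, the space of spherically symmetric functions in `H¹(B_R)`, `B_R ⊆ ℝⁿ`.
As usual the class is represented by its unique representative that is continuous on `(0, R]`
(it is locally absolutely continuous there), so that `χ R` is the trace of `χ` on the boundary
and `deriv χ` is, almost everywhere, the weak radial derivative. The value `χ 0` plays no role. -/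
def MemH1r (n : ℕ) (R : ℝ) (χ : ℝ → ℝ) : Prop :=
  ContinuousOn χ (Ioc 0 R) ∧ MemH1 n R (fun x => χ ‖x‖)

/-- The operator
`L χ = -γ ∂_y (ρ^γ y^(d+1) ∂_y χ) + (2(d-1) - dγ) y^d χ ∂_y ρ^γ`, at interior points. -/
def L (d : ℕ) (γ : ℝ) (ρ χ : ℝ → ℝ) (y : ℝ) : ℝ :=
  -γ * deriv (fun s => ρ s ^ γ * s ^ (d + 1) * deriv χ s) y
    + (2 * ((d : ℝ) - 1) - d * γ) * y ^ d * χ y * deriv (fun s => ρ s ^ γ) y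

/-- The bilinear form `Q[χ₁, χ₂]` of `L` with the Robin boundary condition; `Q[χ, χ]` is the
quadratic form `⟨Lχ, χ⟩` on `H¹_r`. -/
def Q (d : ℕ) (γ R : ℝ) (ρ χ₁ χ₂ : ℝ → ℝ) : ℝ :=
  (∫ y in (0 : ℝ)..R,
      (γ * ρ y ^ γ * y ^ (d + 1) * deriv χ₁ y * deriv χ₂ y
        + (2 * ((d : ℝ) - 1) - d * γ) * y ^ d * χ₁ y * χ₂ y * deriv (fun s => ρ s ^ γ) y))
    + d * γ * R ^ d * χ₁ R * χ₂ R

/-- The weighted norm `‖χ‖_w = ⟨χ, w χ⟩^(1/2)` with `w = y^(d+1) ρ`, on `[0, R]`. -/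
def wNorm (d : ℕ) (R : ℝ) (ρ χ : ℝ → ℝ) : ℝ :=
  Real.sqrt (∫ y in (0 : ℝ)..R, χ y * (y ^ (d + 1) * ρ y * χ y))

/-- The Robin condition `d χ(R) + R χ'(R) = 0` (one-sided derivative at `R`). -/
def Robin (d : ℕ) (R : ℝ) (χ : ℝ → ℝ) : Prop :=
  d * χ R + R * derivWithin χ (Ioc 0 R) R = 0

/-- `χ` is an eigenfunction of `L`, with the Robin condition, for the eigenvalue `μ`:
a nonzero element of `H¹_r(B_R)`, `B_R ⊆ ℝ^(d+2)`, which is `C²` on `(0, R]` and satisfies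
`L χ = μ y^(d+1) ρ χ` and the Robin condition classically. -/
structure IsEigenfunction (d : ℕ) (γ R : ℝ) (ρ : ℝ → ℝ) (μ : ℝ) (χ : ℝ → ℝ) : Prop where
  memH1r : MemH1r (d + 2) R χ
  ne_zero : ∃ y ∈ Ioc 0 R, χ y ≠ 0
  contDiffOn : ContDiffOn ℝ 2 χ (Ioc 0 R)
  eqn : ∀ y ∈ Ioo 0 R, L d γ ρ χ y = μ * (y ^ (d + 1) * ρ y * χ y)
  robin : Robin d R χ

/-- `ζ(y, t)` solves the linearised momentum equation
`y ∂_t² ζ + (2(d-1)/ρ) ζ ∂_y ρ^γ - (γ/ρ) ∂_y (ρ^γ (dζ + y ∂_y ζ)) = 0` in `(0, R)` with the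
boundary condition `d ζ(R, t) + R ∂_y ζ(R, t) = 0`. -/
def IsLinearisedSolution (d : ℕ) (γ R : ℝ) (ρ : ℝ → ℝ) (ζ : ℝ → ℝ → ℝ) : Prop :=
  (∀ t : ℝ, ∀ y ∈ Ioo 0 R,
    y * iteratedDeriv 2 (fun τ => ζ y τ) t
      + 2 * ((d : ℝ) - 1) / ρ y * ζ y t * deriv (fun s => ρ s ^ γ) y
      - γ * (1 / ρ y)
        * deriv (fun s => ρ s ^ γ * (d * ζ s t + s * deriv (fun z => ζ z t) s)) y = 0) ∧
  ∀ t : ℝ, Robin d R (fun y => ζ y t)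

/-- `ζ(y, t) = e^(λt) χ(y)` is a growing mode with rate `lam > 0`: its profile `χ` is a nonzero
element of `H¹_r(B_R)`, `B_R ⊆ ℝ^(d+2)`, is `C²` on `(0, R]`, and `ζ` solves the linearised
momentum equation with its boundary condition. -/
structure IsGrowingMode (d : ℕ) (γ R : ℝ) (ρ : ℝ → ℝ) (lam : ℝ) (χ : ℝ → ℝ) : Prop where
  rate_pos : 0 < lam
  memH1r : MemH1r (d + 2) R χ
  ne_zero : ∃ y ∈ Ioc 0 R, χ y ≠ 0
  contDiffOn : ContDiffOn ℝ 2 χ (Ioc 0 R)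
  solution : IsLinearisedSolution d γ R ρ (fun y t => Real.exp (lam * t) * χ y)

end LaneEmden

end

/-! The eigenvalue equation is a singular Sturm–Liouville equation `(P χ')' = (e - μ w) χ` with `P =
γ ρ^γ y^(d+1)`, `e = (2(d-1) - dγ) y^d ∂_y ρ^γ` and `w = y^(d+1) ρ`. By the momentum equation all
three are of order at most `y^(d+1)` at the origin, and `P` and `w` are exactly of that order. A
positive solution of the boundary value problem is built by shooting in `μ`, and its positivity
alone gives minimality. No minimising sequence and no compact embedding are used.

Shooting. For each `μ` the Volterra equation `φ = 1 + ∫ P⁻¹ ∫ (e - μ w) φ` has a solution, regular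
at `0` with `φ(0) = 1`, that depends continuously on `μ` in the sup norm
(`exists_isRegularSolution_family`). Let `S` be the set of `μ` for which `φ > 0` on `[0, R]` and the
Robin expression `F(μ) = P φ' + β φ` at `R` is nonnegative. It contains very negative `μ` and is
bounded above. At `μ₀ = sup S` the conditions survive as weak inequalities. Uniqueness for the
Cauchy problem makes `φ` positive again, and `F(μ₀) > 0` would put a neighbourhood of `μ₀` into `S`.
So `F(μ₀) = 0` (`exists_ground_state`).

Minimality. For positive `φ`, Picone's identity says that `P χ'² + (e - μ w) χ²` exceeds the
derivative of `χ² P φ'/φ` by a square. Integrated, with the Robin condition at `R`, it gives `μ₀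
‖χ‖² ≤ ⟨Lχ, χ⟩` for every `χ` in `H¹_r` (`IsRegularSolution.picone`). Every eigenfunction satisfies
`⟨Lχ, χ⟩ = ν ‖χ‖²` (`IsEigenfunction.Q_eq`), so `φ` attains the minimum and `μ₀` is the least
eigenvalue.

Both integrations by parts need the one-dimensional description of `H¹_r`: profiles absolutely
continuous away from `0` with weighted square integrable derivative (`MemH1r.isRadialProfile`).
Their boundary terms at `0` are controlled only along a sequence, which is enough. -/

namespace LaneEmden

/-! ### Polar coordinates and averaging over spheres. -/

section Radial

/-- The adjoint, on `L²`, of the composition with a measure preserving map. -/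
theorem exists_memLp_integral_comp_mul_eq {α β : Type*} [MeasurableSpace α] [MeasurableSpace β]
    {μ : Measure α} {ν : Measure β} {f : α → β} (hf : MeasurePreserving f μ ν)
    {G : α → ℝ} (hG : MemLp G 2 μ) :
    ∃ h : β → ℝ, StronglyMeasurable h ∧ MemLp h 2 ν ∧
      ∀ ψ : β → ℝ, MemLp ψ 2 ν → ∫ x, ψ (f x) * G x ∂μ = ∫ y, ψ y * h y ∂ν := by
  let T : Lp ℝ 2 ν →L[ℝ] Lp ℝ 2 μ := (Lp.compMeasurePreservingₗᵢ ℝ f hf).toContinuousLinearMap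
  let h : Lp ℝ 2 ν := ContinuousLinearMap.adjoint T (hG.toLp G)
  refine ⟨h, Lp.stronglyMeasurable h, Lp.memLp h, fun ψ hψ => ?_⟩
  have key : inner ℝ (hψ.toLp ψ) h = inner ℝ (T (hψ.toLp ψ)) (hG.toLp G) :=
    ContinuousLinearMap.adjoint_inner_right T _ _
  rw [L2.inner_def, L2.inner_def] at key
  have e1 : ∫ x, ψ (f x) * G x ∂μ
      = ∫ x, inner ℝ ((T (hψ.toLp ψ) : Lp ℝ 2 μ) x) ((hG.toLp G : Lp ℝ 2 μ) x) ∂μ := by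
    have hT : T (hψ.toLp ψ) = (hψ.comp_measurePreserving hf).toLp _ := rfl
    rw [hT]
    refine integral_congr_ae ?_
    filter_upwards [hG.coeFn_toLp, (hψ.comp_measurePreserving hf).coeFn_toLp] with x h1 h2
    rw [h1, h2]
    simp [mul_comm]
  rw [e1, ← key]
  refine integral_congr_ae ?_
  filter_upwards [hψ.coeFn_toLp] with x h1
  rw [h1]
  simp [mul_comm]

/-- The area of the unit sphere of `ℝⁿ`. -/
noncomputable def sphereArea (n : ℕ) : ℝ := n * volume.real (B n 1)

theorem sphereArea_pos (m : ℕ) : 0 < sphereArea (m + 1) := by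
  unfold sphereArea
  have : 0 < volume.real (B (m + 1) 1) :=
    ENNReal.toReal_pos (Metric.measure_ball_pos _ _ one_pos).ne' measure_ball_lt_top.ne
  positivity

theorem integral_ball_radial (m : ℕ) {R : ℝ} (hR : 0 < R) (f : ℝ → ℝ) :
    ∫ x in B (m + 1) R, f ‖x‖ = sphereArea (m + 1) * ∫ y in (0 : ℝ)..R, y ^ m * f y := by
  have h1 : ∫ x in B (m + 1) R, f ‖x‖
      = ∫ x : EuclideanSpace ℝ (Fin (m + 1)), (Iio R).indicator f ‖x‖ := by
    rw [← integral_indicator measurableSet_ball]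
    refine integral_congr_ae (.of_forall fun x => ?_)
    simp [indicator]
  rw [h1, integral_fun_norm_addHaar volume ((Iio R).indicator f)]
  have h2 : ∀ y : ℝ, y ^ m • (Iio R).indicator f y = (Iio R).indicator (fun y => y ^ m * f y) y := by
    intro y
    by_cases hy : y < R <;> simp [hy]
  simp only [finrank_euclideanSpace, Fintype.card_fin, Nat.add_sub_cancel, h2]
  rw [setIntegral_indicator measurableSet_Iio, Ioi_inter_Iio, intervalIntegral.integral_of_le hR.le,
    integral_Ioc_eq_integral_Ioo, nsmul_eq_mul, smul_eq_mul, sphereArea]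
  ring

theorem integrableOn_ball_radial (m : ℕ) {R : ℝ} {f : ℝ → ℝ} :
    IntegrableOn (fun x => f ‖x‖) (B (m + 1) R) ↔
      IntegrableOn (fun y => y ^ m * f y) (Ioc 0 R) := by
  have := integrableOn_fun_norm_addHaar (E := EuclideanSpace ℝ (Fin (m + 1))) volume
    (f := f) (r := R)
  rw [integrableOn_Ioc_iff_integrableOn_Ioo]
  simpa using this

end Radial

/-! ### The du Bois-Reymond lemma on `(0, R)`. -/

section DuBoisReymond

theorem exists_Icc_of_isCompact_subset_Ioo {R : ℝ} (hR : 0 < R) {K : Set ℝ} (hK : IsCompact K)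
    (hKR : K ⊆ Ioo 0 R) : ∃ a b : ℝ, 0 < a ∧ a < b ∧ b < R ∧ K ⊆ Icc a b := by
  rcases K.eq_empty_or_nonempty with rfl | hne
  · exact ⟨R / 3, R / 2, by linarith, by linarith, by linarith, empty_subset _⟩
  · obtain ⟨a, ha, ha'⟩ := hK.exists_isLeast hne
    obtain ⟨b, hb, hb'⟩ := hK.exists_isGreatest hne
    refine ⟨a / 2, b, by linarith [(hKR ha).1], ?_, (hKR hb).2, fun x hx => ⟨?_, hb' hx⟩⟩
    · linarith [(hKR ha).1, ha' hb]
    · linarith [(hKR ha).1, ha' hx]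

/-- A smooth function with compact support in `(0, R)` and integral `0` has a primitive of the
same kind. -/
theorem exists_primitive_of_integral_eq_zero {R : ℝ} (hR : 0 < R) {θ : ℝ → ℝ}
    (hθ : ContDiff ℝ (⊤ : ℕ∞) θ) (hc : HasCompactSupport θ) (hs : tsupport θ ⊆ Ioo 0 R)
    (h0 : ∫ y in (0 : ℝ)..R, θ y = 0) :
    ∃ ψ : ℝ → ℝ, ContDiff ℝ (⊤ : ℕ∞) ψ ∧ HasCompactSupport ψ ∧ tsupport ψ ⊆ Ioo 0 R ∧
      deriv ψ = θ := by
  obtain ⟨a, b, ha, hab, hb, hK⟩ := exists_Icc_of_isCompact_subset_Ioo hR hc hs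
  have hz : ∀ y, y ∉ Icc a b → θ y = 0 := fun y hy => image_eq_zero_of_notMem_tsupport
    fun h => hy (hK h)
  have hd : ∀ y, HasDerivAt (fun y => ∫ t in (0 : ℝ)..y, θ t) (θ y) y := fun y =>
    hθ.continuous.integral_hasStrictDerivAt 0 y |>.hasDerivAt
  have hderiv : deriv (fun y => ∫ t in (0 : ℝ)..y, θ t) = θ := funext fun y => (hd y).deriv
  have hsupp : Function.support (fun y => ∫ t in (0 : ℝ)..y, θ t) ⊆ Icc a b := by
    intro y hy
    by_contra hn
    refine hy ?_
    have hii : ∀ u v : ℝ, IntervalIntegrable θ volume u v := fun u v =>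
      hθ.continuous.intervalIntegrable u v
    rcases not_and_or.1 hn with h | h
    · have : ∫ t in (0 : ℝ)..y, θ t = ∫ t in (0 : ℝ)..y, (0 : ℝ) := by
        refine intervalIntegral.integral_congr fun t ht => hz t fun h' => ?_
        rcases le_total 0 y with h0 | h0
        · rw [uIcc_of_le h0] at ht
          linarith [ht.2, h'.1]
        · rw [uIcc_of_ge h0] at ht
          linarith [ht.2, h'.1]
      simpa using this
    -- To the right of `b` the vanishing total integral `h0` is what makes the primitive vanish.
    · have h2 : ∫ t in y..R, θ t = ∫ t in y..R, (0 : ℝ) := by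
        refine intervalIntegral.integral_congr fun t ht => hz t fun h' => ?_
        rcases le_total y R with h0 | h0
        · rw [uIcc_of_le h0] at ht
          linarith [ht.1, h'.2]
        · rw [uIcc_of_ge h0] at ht
          linarith [ht.1, h'.2]
      have h3 := intervalIntegral.integral_add_adjacent_intervals (hii 0 y) (hii y R)
      simp only [intervalIntegral.integral_zero] at h2
      simp only
      linarith
  have hts : tsupport (fun y => ∫ t in (0 : ℝ)..y, θ t) ⊆ Icc a b :=
    closure_minimal hsupp isClosed_Icc
  refine ⟨_, ?_, ?_, hts.trans fun y hy => ⟨by linarith [hy.1], by linarith [hy.2]⟩, hderiv⟩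
  · have : ((⊤ : ℕ∞) : WithTop ℕ∞) = (⊤ : ℕ∞) + 1 := rfl
    rw [this, contDiff_succ_iff_deriv]
    refine ⟨fun y => (hd y).differentiableAt, by simp, by rwa [hderiv]⟩
  · exact isCompact_Icc.of_isClosed_subset (isClosed_tsupport _) hts

/-- Subtracting the primitive of `h` leaves a continuous function with zero weak derivative. Since
test functions of mean zero are derivatives of test functions, that function is constant almost
everywhere, and by continuity everywhere. -/
theorem eq_add_integral_of_weak_deriv {R : ℝ} (hR : 0 < R) {χ h : ℝ → ℝ}
    (hχ : ContinuousOn χ (Ioc 0 R))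
    (hh : ∀ a ∈ Ioc 0 R, IntervalIntegrable h volume a R)
    (hw : ∀ ψ : ℝ → ℝ, ContDiff ℝ (⊤ : ℕ∞) ψ → HasCompactSupport ψ → tsupport ψ ⊆ Ioo 0 R →
      ∫ y in (0 : ℝ)..R, χ y * deriv ψ y = -∫ y in (0 : ℝ)..R, h y * ψ y) :
    ∃ c : ℝ, ∀ y ∈ Ioc 0 R, χ y = c + ∫ t in R..y, h t := by
  set H : ℝ → ℝ := fun y => ∫ t in R..y, h t with hH
  have hAC : ∀ a ∈ Ioc 0 R, AbsolutelyContinuousOnInterval H a R := fun a ha =>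
    (hh a ha).absolutelyContinuousOnInterval_intervalIntegral (by simp)
  have hHc : ContinuousOn H (Ioc 0 R) := by
    intro y hy
    have h1 := (hAC (y / 2) ⟨by linarith [hy.1], by linarith [hy.1, hy.2]⟩).continuousOn
    rw [uIcc_of_le (by linarith [hy.1, hy.2])] at h1
    refine (h1 y ⟨by linarith [hy.1], hy.2⟩).mono_of_mem_nhdsWithin ?_
    filter_upwards [self_mem_nhdsWithin, mem_nhdsWithin_of_mem_nhds
      (Ioi_mem_nhds (show y / 2 < y by linarith [hy.1]))] with z hz hz'
    exact ⟨le_of_lt hz', hz.2⟩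
  -- integrals against functions supported in a compact subinterval
  have hred : ∀ (a b : ℝ) (g : ℝ → ℝ), 0 < a → a < b → b < R → (∀ y, y ∉ Icc a b → g y = 0) →
      ∫ y in (0 : ℝ)..R, g y = ∫ y in a..R, g y := by
    intro a b g ha hab hb hz
    rw [intervalIntegral.integral_of_le hR.le, intervalIntegral.integral_of_le (by linarith)]
    refine setIntegral_eq_of_subset_of_ae_sdiff_eq_zero measurableSet_Ioc.nullMeasurableSet
      (fun y hy => ⟨by linarith [hy.1], hy.2⟩) ?_
    have hne : ∀ᵐ y : ℝ, y ≠ a := by simp [ae_iff]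
    filter_upwards [hne] with y hya hy
    refine hz y fun h' => hy.2 ⟨lt_of_le_of_ne h'.1 (Ne.symm hya), hy.1.2⟩
  have hzero : ∀ ψ : ℝ → ℝ, ContDiff ℝ (⊤ : ℕ∞) ψ → HasCompactSupport ψ → tsupport ψ ⊆ Ioo 0 R →
      ∫ y in (0 : ℝ)..R, (χ y - H y) * deriv ψ y = 0 := by
    intro ψ h1 h2 h3
    obtain ⟨a, b, ha, hab, hb, hK⟩ := exists_Icc_of_isCompact_subset_Ioo hR h2 h3
    have hz : ∀ y, y ∉ Icc a b → ψ y = 0 := fun y hy => image_eq_zero_of_notMem_tsupport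
      fun h => hy (hK h)
    have hz' : ∀ y, y ∉ Icc a b → deriv ψ y = 0 := fun y hy => by
      by_contra hne
      exact hy (hK (support_deriv_subset hne))
    have hsub : Icc a R ⊆ Ioc 0 R := fun y hy => ⟨by linarith [hy.1], hy.2⟩
    have haR : a ≤ R := by linarith
    have hdc : Continuous (deriv ψ) := h1.continuous_deriv (by simp)
    have i1 : IntervalIntegrable (fun y => χ y * deriv ψ y) volume a R := by
      refine ContinuousOn.intervalIntegrable ?_
      rw [uIcc_of_le haR]
      exact (hχ.mono hsub).mul hdc.continuousOn
    have i2 : IntervalIntegrable (fun y => H y * deriv ψ y) volume a R := by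
      refine ContinuousOn.intervalIntegrable ?_
      rw [uIcc_of_le haR]
      exact (hHc.mono hsub).mul hdc.continuousOn
    have hw' := hw ψ h1 h2 h3
    rw [hred a b _ ha hab hb (fun y hy => by rw [hz' y hy, mul_zero]),
      hred a b _ ha hab hb (fun y hy => by rw [hz y hy, mul_zero])] at hw'
    rw [hred a b _ ha hab hb (fun y hy => by rw [hz' y hy, mul_zero])]
    simp only [sub_mul]
    rw [intervalIntegral.integral_sub i1 i2, hw']
    have hψAC : AbsolutelyContinuousOnInterval ψ a R :=
      (h1.of_le (by exact_mod_cast le_top)).contDiffOn.absolutelyContinuousOnInterval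
    rw [(hAC a ⟨ha, haR⟩).integral_mul_deriv_eq_deriv_mul hψAC]
    have hψR : ψ R = 0 := hz R fun h => by linarith [h.2]
    -- The point `a` may belong to the support interval, but `ψ` vanishes to its left and is
    -- continuous.
    have hψa : ψ a = 0 := by
      by_contra hne
      have hcl : ∀ᶠ y in nhds a, ψ y ≠ 0 := h1.continuous.continuousAt.eventually_ne hne
      obtain ⟨l, u, hlu, hsub'⟩ := mem_nhds_iff_exists_Ioo_subset.1 hcl
      have h5 : (l + a) / 2 ∈ Ioo l u := ⟨by linarith [hlu.1], by linarith [hlu.1, hlu.2]⟩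
      exact hsub' h5 (hz _ fun h => by linarith [h.1, hlu.1])
    have hde : ∫ y in a..R, deriv H y * ψ y = ∫ y in a..R, h y * ψ y := by
      refine intervalIntegral.integral_congr_ae ?_
      filter_upwards [(hh a ⟨ha, haR⟩).ae_hasDerivAt_integral] with y hy hy'
      rw [(hy (uIoc_subset_uIcc hy') R (by simp)).deriv]
    rw [hde, hψR, hψa]
    ring
  -- a bump function of integral one
  obtain ⟨η, hη1, hη2, hη3, hη4⟩ : ∃ η : ℝ → ℝ, ContDiff ℝ (⊤ : ℕ∞) η ∧ HasCompactSupport η ∧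
      tsupport η ⊆ Ioo 0 R ∧ ∫ y in (0 : ℝ)..R, η y = 1 := by
    let f : ContDiffBump (R / 2) := ⟨R / 8, R / 4, by linarith, by linarith⟩
    have hs : tsupport (f.normed volume) ⊆ Ioo 0 R := by
      rw [f.tsupport_normed_eq]
      intro y hy
      rw [Metric.mem_closedBall, Real.dist_eq, abs_le] at hy
      have : f.rOut = R / 4 := rfl
      constructor <;> linarith [hy.1, hy.2]
    refine ⟨f.normed volume, f.contDiff_normed, f.hasCompactSupport_normed, hs, ?_⟩
    rw [intervalIntegral.integral_of_le hR.le, ← f.integral_normed (μ := volume)]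
    refine setIntegral_eq_integral_of_forall_compl_eq_zero fun y hy => ?_
    exact image_eq_zero_of_notMem_tsupport fun h => hy ⟨(hs h).1, (hs h).2.le⟩
  set u : ℝ → ℝ := fun y => χ y - H y with hu
  have huc : ContinuousOn u (Ioc 0 R) := hχ.sub hHc
  set c := ∫ y in (0 : ℝ)..R, u y * η y with hcdef
  have hint : ∀ g : ℝ → ℝ, Continuous g → HasCompactSupport g → tsupport g ⊆ Ioo 0 R →
      IntervalIntegrable (fun y => u y * g y) volume 0 R := by
    intro g h1 h2 h3
    have hcont : Continuous (fun y => u y * g y) := by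
      refine continuous_of_tsupport (f := fun y => u y * g y) fun x hx => ?_
      have hx' : x ∈ Ioo 0 R := h3 (tsupport_mul_subset_right hx)
      exact (huc.continuousAt (Ioc_mem_nhds hx'.1 hx'.2)).mul h1.continuousAt
    exact hcont.intervalIntegrable _ _
  -- Any test function `θ` differs from `(∫ θ) η` by one of mean zero, hence by a derivative.
  -- Testing `u` therefore gives `∫ u θ = c ∫ θ`.
  have hae : ∀ᵐ y : ℝ, y ∈ Ioo 0 R → u y - c = 0 := by
    refine isOpen_Ioo.ae_eq_zero_of_integral_contDiff_smul_eq_zero ?_ fun θ h1 h2 h3 => ?_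
    · exact ((huc.mono Ioo_subset_Ioc_self).sub continuousOn_const).locallyIntegrableOn
        measurableSet_Ioo
    set I := ∫ y in (0 : ℝ)..R, θ y with hI
    have hθ' : ContDiff ℝ (⊤ : ℕ∞) (fun y => θ y - I * η y) := h1.sub (contDiff_const.mul hη1)
    have hts : tsupport (fun y => θ y - I * η y) ⊆ tsupport θ ∪ tsupport η := by
      refine (tsupport_sub θ (fun y => I * η y)).trans (union_subset_union_right _ ?_)
      exact tsupport_mul_subset_right
    have hcs : HasCompactSupport (fun y => θ y - I * η y) :=
      (h2.isCompact.union hη2.isCompact).of_isClosed_subset (isClosed_tsupport _) hts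
    have hsR : tsupport (fun y => θ y - I * η y) ⊆ Ioo 0 R := hts.trans (union_subset h3 hη3)
    obtain ⟨ψ, p1, p2, p3, p4⟩ := exists_primitive_of_integral_eq_zero hR hθ' hcs hsR (by
      rw [intervalIntegral.integral_sub (h1.continuous.intervalIntegrable _ _)
        ((hη1.continuous.intervalIntegrable _ _).const_mul I),
        intervalIntegral.integral_const_mul, hη4]
      simp [hI])
    have h5 := hzero ψ p1 p2 p3
    rw [p4] at h5
    have h6 : ∫ y in (0 : ℝ)..R, (χ y - H y) * (θ y - I * η y)
        = (∫ y in (0 : ℝ)..R, u y * θ y) - I * c := by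
      rw [hcdef, ← intervalIntegral.integral_const_mul, ← intervalIntegral.integral_sub
        (hint θ h1.continuous h2 h3) ((hint η hη1.continuous hη2 hη3).const_mul I)]
      refine intervalIntegral.integral_congr fun y _ => ?_
      simp only [hu]
      ring
    have h7 : ∫ y, θ y • (u y - c) = ∫ y in (0 : ℝ)..R, θ y • (u y - c) := by
      rw [intervalIntegral.integral_of_le hR.le]
      refine (setIntegral_eq_integral_of_forall_compl_eq_zero fun y hy => ?_).symm
      rw [image_eq_zero_of_notMem_tsupport fun h => hy ⟨(h3 h).1, (h3 h).2.le⟩, zero_smul]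
    have h8 : ∫ y in (0 : ℝ)..R, θ y • (u y - c) = (∫ y in (0 : ℝ)..R, u y * θ y) - I * c := by
      rw [hI, ← intervalIntegral.integral_mul_const, ← intervalIntegral.integral_sub
        (hint θ h1.continuous h2 h3) ((h1.continuous.intervalIntegrable _ _).mul_const c)]
      refine intervalIntegral.integral_congr fun y _ => ?_
      simp only [smul_eq_mul]
      ring
    rw [h7, h8, ← h6, h5]
  have heq : EqOn u (fun _ => c) (Ioc 0 R) := by
    refine Measure.eqOn_Ioc_of_ae_eq volume ?_ huc continuousOn_const
    rw [Filter.EventuallyEq, ← restrict_Ioo_eq_restrict_Ioc, ae_restrict_iff' measurableSet_Ioo]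
    filter_upwards [hae] with y hy hy'
    linarith [hy hy']
  refine ⟨c, fun y hy => ?_⟩
  have := heq hy
  simp only [hu] at this
  linarith

end DuBoisReymond
-- Radial `H¹` functions and their one-dimensional profiles.
section WeakDerivative

theorem contDiff_of_contDiffAt_tsupport {E : Type*} [NormedAddCommGroup E] [NormedSpace ℝ E]
    {k : WithTop ℕ∞} {f : E → ℝ} (hf : ∀ x ∈ tsupport f, ContDiffAt ℝ k f x) :
    ContDiff ℝ k f := by
  refine contDiff_iff_contDiffAt.2 fun x => ?_
  by_cases hx : x ∈ tsupport f
  · exact hf x hx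
  · exact contDiffAt_const.congr_of_eventuallyEq (notMem_tsupport_iff_eventuallyEq.1 hx)

theorem hasFDerivAt_comp_norm {n : ℕ} {φ : ℝ → ℝ} {φ' : ℝ} {x : EuclideanSpace ℝ (Fin n)}
    (hx : x ≠ 0) (hφ : HasDerivAt φ φ' ‖x‖) :
    HasFDerivAt (fun x : EuclideanSpace ℝ (Fin n) => φ ‖x‖) ((φ' / ‖x‖) • innerSL ℝ x) x := by
  have hx' : ‖x‖ ≠ 0 := norm_ne_zero_iff.2 hx
  have h1 : HasFDerivAt (fun x : EuclideanSpace ℝ (Fin n) => Real.sqrt (‖x‖ ^ 2)) _ x :=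
    (hasStrictFDerivAt_norm_sq x).hasFDerivAt.sqrt (by positivity)
  have h2 : (fun x : EuclideanSpace ℝ (Fin n) => Real.sqrt (‖x‖ ^ 2)) = fun x => ‖x‖ :=
    funext fun x => Real.sqrt_sq (norm_nonneg x)
  rw [h2] at h1
  have h3 := hφ.comp_hasFDerivAt x h1
  refine h3.congr_fderiv ?_
  rw [Real.sqrt_sq (norm_nonneg x)]
  ext v
  simp
  field_simp

theorem tsupport_comp_norm_subset {n : ℕ} {R : ℝ} {κ : ℝ → ℝ} (hκ : tsupport κ ⊆ Ioo 0 R) :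
    tsupport (fun x : EuclideanSpace ℝ (Fin n) => κ ‖x‖) ⊆ {x | 0 < ‖x‖ ∧ ‖x‖ < R} :=
  (tsupport_comp_subset_preimage κ continuous_norm).trans fun _ hx => hκ hx

theorem hasCompactSupport_comp_norm {n : ℕ} {R : ℝ} {κ : ℝ → ℝ} (hκ : tsupport κ ⊆ Ioo 0 R) :
    HasCompactSupport (fun x : EuclideanSpace ℝ (Fin n) => κ ‖x‖) :=
  (isCompact_closedBall (0 : EuclideanSpace ℝ (Fin n)) R).of_isClosed_subset (isClosed_tsupport _)
    ((tsupport_comp_norm_subset hκ).trans fun x hx => by simpa using hx.2.le)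

theorem contDiff_comp_norm {n : ℕ} {R : ℝ} {κ : ℝ → ℝ} (hκ : tsupport κ ⊆ Ioo 0 R)
    (hs : ContDiff ℝ (⊤ : ℕ∞) κ) :
    ContDiff ℝ (⊤ : ℕ∞) (fun x : EuclideanSpace ℝ (Fin n) => κ ‖x‖) := by
  refine contDiff_of_contDiffAt_tsupport fun x hx => ?_
  have hx0 : x ≠ 0 := norm_pos_iff.1 (tsupport_comp_norm_subset hκ hx).1
  exact hs.contDiffAt.comp x (contDiffAt_norm ℝ hx0)

/-- The weak gradient of a radial function, tested with the radial field `κ(|x|) x`. -/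
theorem IsWeakGradient.integral_radial_field {n : ℕ} {R : ℝ} {χ : ℝ → ℝ}
    {g : EuclideanSpace ℝ (Fin n) → EuclideanSpace ℝ (Fin n)}
    (hg : IsWeakGradient n R (fun x => χ ‖x‖) g)
    (hχ2 : MemLp (fun x : EuclideanSpace ℝ (Fin n) => χ ‖x‖) 2 (volume.restrict (B n R)))
    (hg2 : MemLp g 2 (volume.restrict (B n R)))
    {κ : ℝ → ℝ} (hκ : tsupport κ ⊆ Ioo 0 R) (hs : ContDiff ℝ (⊤ : ℕ∞) κ) :
    ∫ x in B n R, χ ‖x‖ * (n * κ ‖x‖ + ‖x‖ * deriv κ ‖x‖)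
      = -∫ x in B n R, inner ℝ (g x) x * κ ‖x‖ := by
  have : IsFiniteMeasure (volume.restrict (B n R)) :=
    ⟨by rw [Measure.restrict_apply_univ]; exact measure_ball_lt_top⟩
  -- The weak gradient is tested with each component of the field `κ(|x|) x`. Summing over `i`
  -- produces its divergence `n κ + r κ'`.
  set Φ : Fin n → EuclideanSpace ℝ (Fin n) → ℝ := fun i x => κ ‖x‖ * x i with hΦ
  have hc : ∀ i : Fin n, ContDiff ℝ (⊤ : ℕ∞) (fun x : EuclideanSpace ℝ (Fin n) => x i) := fun i =>
    (EuclideanSpace.proj (𝕜 := ℝ) i).contDiff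
  have h1 : ∀ i, ContDiff ℝ (⊤ : ℕ∞) (Φ i) := fun i => (contDiff_comp_norm hκ hs).mul (hc i)
  have h2 : ∀ i, HasCompactSupport (Φ i) := fun i => (hasCompactSupport_comp_norm hκ).mul_right
  have h3 : ∀ i, tsupport (Φ i) ⊆ B n R := fun i =>
    tsupport_mul_subset_left.trans ((tsupport_comp_norm_subset hκ).trans fun x hx => by
      simpa using hx.2)
  set e : Fin n → EuclideanSpace ℝ (Fin n) := fun i => EuclideanSpace.single i 1 with he
  have hbd : ∀ f : EuclideanSpace ℝ (Fin n) → ℝ, Continuous f → HasCompactSupport f →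
      ∃ C, ∀ x, ‖f x‖ ≤ C := fun f hf hf' => hf'.exists_bound_of_continuous hf
  have hfd : ∀ i, Continuous fun x => fderiv ℝ (Φ i) x (e i) := fun i =>
    ((h1 i).continuous_fderiv (by simp)).clm_apply continuous_const
  have hfc : ∀ i, HasCompactSupport fun x => fderiv ℝ (Φ i) x (e i) := fun i =>
    (h2 i).fderiv_apply (𝕜 := ℝ) (e i)
  have i1 : ∀ i, Integrable (fun x => χ ‖x‖ * fderiv ℝ (Φ i) x (e i))
      (volume.restrict (B n R)) := fun i => by
    obtain ⟨C, hC⟩ := hbd _ (hfd i) (hfc i)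
    exact (hχ2.integrable one_le_two).mul_bdd (hfd i).aestronglyMeasurable (.of_forall hC)
  have i2 : ∀ i, Integrable (fun x => inner ℝ (g x) (e i) * Φ i x)
      (volume.restrict (B n R)) := fun i => by
    obtain ⟨C, hC⟩ := hbd _ (h1 i).continuous (h2 i)
    exact ((hg2.integrable one_le_two).inner_const (e i)).mul_bdd
      (h1 i).continuous.aestronglyMeasurable (.of_forall hC)
  have hsum := Finset.sum_congr (rfl : (Finset.univ : Finset (Fin n)) = Finset.univ)
    (fun i _ => hg (Φ i) (h1 i) (h2 i) (h3 i) (e i))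
  rw [← integral_finsetSum _ (fun i _ => i1 i), Finset.sum_neg_distrib,
    ← integral_finsetSum _ (fun i _ => i2 i)] at hsum
  have e2 : ∀ x : EuclideanSpace ℝ (Fin n),
      ∑ i, inner ℝ (g x) (e i) * Φ i x = inner ℝ (g x) x * κ ‖x‖ := by
    intro x
    simp only [hΦ, he, PiLp.inner_apply, Finset.sum_mul]
    simp
    refine Finset.sum_congr rfl fun i _ => by ring
  have e1 : ∀ x : EuclideanSpace ℝ (Fin n),
      ∑ i, χ ‖x‖ * fderiv ℝ (Φ i) x (e i) = χ ‖x‖ * (n * κ ‖x‖ + ‖x‖ * deriv κ ‖x‖) := by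
    intro x
    rw [← Finset.mul_sum]
    congr 1
    by_cases hx : x = 0
    · subst hx
      have hz : ∀ i, fderiv ℝ (Φ i) 0 = 0 := fun i => by
        by_contra hne
        have : (0 : EuclideanSpace ℝ (Fin n)) ∈ tsupport (fun x => κ ‖x‖) :=
          tsupport_mul_subset_left (support_fderiv_subset ℝ hne)
        simpa using (tsupport_comp_norm_subset hκ this).1
      have hk : κ 0 = 0 := image_eq_zero_of_notMem_tsupport fun h => lt_irrefl _ (hκ h).1
      simp [hz, hk]
    · have hx' : ‖x‖ ≠ 0 := norm_ne_zero_iff.2 hx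
      have hd : HasDerivAt κ (deriv κ ‖x‖) ‖x‖ := (hs.differentiable (by simp) _).hasDerivAt
      have hf : ∀ i, fderiv ℝ (Φ i) x (e i)
          = κ ‖x‖ + deriv κ ‖x‖ / ‖x‖ * (x i) ^ 2 := fun i => by
        have := (hasFDerivAt_comp_norm hx hd).mul
          (EuclideanSpace.proj (𝕜 := ℝ) i : EuclideanSpace ℝ (Fin n) →L[ℝ] ℝ).hasFDerivAt
        have h' : HasFDerivAt (Φ i) _ x := this
        rw [h'.fderiv]
        simp [he, EuclideanSpace.inner_single_right]
        ring
      simp only [hf, Finset.sum_add_distrib, ← Finset.mul_sum]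
      have hn : ∑ i, (x i) ^ 2 = ‖x‖ ^ 2 := by
        rw [EuclideanSpace.norm_sq_eq]
        simp
      rw [hn]
      simp
      field_simp
  simp only [e1, e2] at hsum
  exact hsum

/-- Sobolev regularity of the profile of a radial `H¹` function. -/
theorem MemH1r.exists_weak_deriv {m : ℕ} {R : ℝ} (hR : 0 < R) {χ : ℝ → ℝ}
    (hχ : MemH1r (m + 1) R χ) :
    ∃ h : ℝ → ℝ, StronglyMeasurable h ∧ IntegrableOn (fun y => y ^ m * h y ^ 2) (Ioc 0 R) ∧
      ∀ ψ : ℝ → ℝ, ContDiff ℝ (⊤ : ℕ∞) ψ → HasCompactSupport ψ → tsupport ψ ⊆ Ioo 0 R →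
        ∫ y in (0 : ℝ)..R, χ y * deriv ψ y = -∫ y in (0 : ℝ)..R, h y * ψ y := by
  obtain ⟨-, hχ2, g, hg2, hg⟩ := hχ
  set μ := volume.restrict (B (m + 1) R) with hμ
  have : IsFiniteMeasure μ := ⟨by rw [hμ, Measure.restrict_apply_univ]; exact measure_ball_lt_top⟩
  have hmp : MeasurePreserving (fun x : EuclideanSpace ℝ (Fin (m + 1)) => ‖x‖) μ
      (μ.map fun x => ‖x‖) := ⟨measurable_norm, rfl⟩
  have : IsFiniteMeasure (μ.map fun x => ‖x‖) := Measure.isFiniteMeasure_map μ _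
  -- This is the radial component of the weak gradient. It need not be known to be radial: the `h`
  -- extracted below is its average over spheres, which is all that radial test functions see.
  have hG : MemLp (fun x => inner ℝ (g x) (‖x‖⁻¹ • x)) 2 μ := by
    refine hg2.of_le ?_ (.of_forall fun x => ?_)
    · refine hg2.1.inner ?_
      exact (measurable_norm.inv.smul measurable_id).aestronglyMeasurable
    · refine (norm_inner_le_norm _ _).trans ?_
      rw [norm_smul, norm_inv, norm_norm]
      have : ‖x‖⁻¹ * ‖x‖ ≤ 1 := inv_mul_le_one
      nlinarith [norm_nonneg (g x)]
  obtain ⟨h, hm, hh2, hh⟩ := exists_memLp_integral_comp_mul_eq hmp hG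
  refine ⟨h, hm, ?_, fun ψ p1 p2 p3 => ?_⟩
  · have := (hh2.comp_measurePreserving hmp).integrable_sq
    exact (integrableOn_ball_radial m (f := fun y => h y ^ 2)).1 this
  -- In dimension `m + 1` the divergence of `κ(|x|) x` is `r^(-m) (r^(m+1) κ)'`. This choice of `κ`
  -- turns it into `r^(-m) ψ'`, and polar coordinates remove the weight.
  set κ : ℝ → ℝ := fun y => ψ y * (y ^ (m + 1))⁻¹ with hκdef
  have hκs : tsupport κ ⊆ tsupport ψ := tsupport_mul_subset_left
  have hκ : ContDiff ℝ (⊤ : ℕ∞) κ := contDiff_of_contDiffAt_tsupport fun y hy => by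
    have hy0 : y ≠ 0 := (p3 (hκs hy)).1.ne'
    exact p1.contDiffAt.mul ((contDiffAt_id.pow _).inv (by simpa using hy0))
  have key := hg.integral_radial_field hχ2 hg2 (hκs.trans p3) hκ
  rw [integral_ball_radial m hR (fun y => χ y * (((m + 1 : ℕ) : ℝ) * κ y + y * deriv κ y))] at key
  have hr : ∫ x in B (m + 1) R, inner ℝ (g x) x * κ ‖x‖
      = sphereArea (m + 1) * ∫ y in (0 : ℝ)..R, y ^ m * (y * κ y * h y) := by
    rw [← integral_ball_radial m hR (fun y => y * κ y * h y)]
    have hb : MemLp (fun y : ℝ => y * κ y) 2 (μ.map fun x => ‖x‖) := by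
      have hc : Continuous (fun y : ℝ => y * κ y) := continuous_id.mul hκ.continuous
      have hcs : HasCompactSupport (fun y : ℝ => y * κ y) :=
        HasCompactSupport.mul_left (p2.of_isClosed_subset (isClosed_tsupport _) hκs)
      obtain ⟨C, hC⟩ := hcs.exists_bound_of_continuous hc
      exact MemLp.of_bound hc.aestronglyMeasurable C (.of_forall hC)
    have h1 := hh _ hb
    rw [integral_map (f := fun y => y * κ y * h y) measurable_norm.aemeasurable
      (hb.1.mul hh2.1)] at h1
    rw [← h1]
    refine integral_congr_ae (.of_forall fun x => ?_)
    simp only [inner_smul_right]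
    by_cases hx : x = 0
    · simp [hx]
    · have hx' : ‖x‖ ≠ 0 := norm_ne_zero_iff.2 hx
      field_simp
  rw [hr, ← mul_neg] at key
  have key' := mul_left_cancel₀ (sphereArea_pos m).ne' key
  have c1 : ∫ y in (0 : ℝ)..R, y ^ m * (χ y * (((m + 1 : ℕ) : ℝ) * κ y + y * deriv κ y))
      = ∫ y in (0 : ℝ)..R, χ y * deriv ψ y := by
    rw [intervalIntegral.integral_of_le hR.le, intervalIntegral.integral_of_le hR.le]
    refine setIntegral_congr_fun measurableSet_Ioc fun y hy => ?_
    have hy0 : y ≠ 0 := hy.1.ne'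
    have hd : HasDerivAt ψ (((m + 1 : ℕ) : ℝ) * y ^ m * κ y + y ^ (m + 1) * deriv κ y) y := by
      have h1 := (hasDerivAt_pow (m + 1) y).mul (hκ.differentiable (by simp) y).hasDerivAt
      refine h1.congr_of_eventuallyEq ?_ |>.congr_deriv (by simp)
      filter_upwards [isOpen_ne.mem_nhds hy0] with z hz
      simp only [hκdef, Pi.mul_apply]
      have : z ≠ 0 := hz
      field_simp
    rw [hd.deriv]
    ring
  have c2 : ∫ y in (0 : ℝ)..R, y ^ m * (y * κ y * h y) = ∫ y in (0 : ℝ)..R, h y * ψ y := by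
    rw [intervalIntegral.integral_of_le hR.le, intervalIntegral.integral_of_le hR.le]
    refine setIntegral_congr_fun measurableSet_Ioc fun y hy => ?_
    have hy0 : y ≠ 0 := hy.1.ne'
    simp only [hκdef]
    field_simp
    ring
  rw [c1, c2] at key'
  exact key'

theorem absolutelyContinuousOnInterval_congr {f g : ℝ → ℝ} {a b : ℝ}
    (hf : AbsolutelyContinuousOnInterval f a b) (hfg : EqOn g f (uIcc a b)) :
    AbsolutelyContinuousOnInterval g a b := by
  rw [absolutelyContinuousOnInterval_iff] at hf ⊢
  intro ε hε
  obtain ⟨δ, hδ, h⟩ := hf ε hε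
  refine ⟨δ, hδ, fun E hE hE' => ?_⟩
  convert h E hE hE' using 1
  refine Finset.sum_congr rfl fun i hi => ?_
  rw [hfg (hE.1 i hi).1, hfg (hE.1 i hi).2]

/-- The one-dimensional description of (profiles of) radial `H¹` functions. -/
structure IsRadialProfile (m : ℕ) (R : ℝ) (χ : ℝ → ℝ) : Prop where
  ac : ∀ a ∈ Ioc 0 R, AbsolutelyContinuousOnInterval χ a R
  integrableOn_sq : IntegrableOn (fun y => y ^ m * χ y ^ 2) (Ioc 0 R)
  integrableOn_deriv_sq : IntegrableOn (fun y => y ^ m * deriv χ y ^ 2) (Ioc 0 R)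

/-- Away from the origin the weight is bounded below, so the weak derivative `h` is integrable on
each `[a, R]`. The du Bois-Reymond lemma then makes `χ` a primitive of `h`, with `χ' = h` almost
everywhere. -/
theorem MemH1r.isRadialProfile {m : ℕ} {R : ℝ} (hR : 0 < R) {χ : ℝ → ℝ}
    (hχ : MemH1r (m + 1) R χ) : IsRadialProfile m R χ := by
  obtain ⟨h, hm, hi, hw⟩ := hχ.exists_weak_deriv hR
  have hh : ∀ a ∈ Ioc 0 R, IntervalIntegrable h volume a R := by
    intro a ha
    rw [intervalIntegrable_iff_integrableOn_Ioc_of_le ha.2]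
    have h1 : IntegrableOn (fun y => 1 + (a ^ m)⁻¹ * (y ^ m * h y ^ 2)) (Ioc a R) :=
      (integrableOn_const (by simp)).add
        ((hi.mono_set (Ioc_subset_Ioc_left ha.1.le)).const_mul _)
    refine Integrable.mono' h1 hm.aestronglyMeasurable ?_
    filter_upwards [ae_restrict_mem measurableSet_Ioc] with y hy
    have hp : 0 < a ^ m := pow_pos ha.1 m
    have h2 : 1 ≤ (a ^ m)⁻¹ * y ^ m := by
      rw [← div_eq_inv_mul, one_le_div hp]
      exact pow_le_pow_left₀ ha.1.le hy.1.le m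
    rw [Real.norm_eq_abs, ← mul_assoc]
    have h3 : |h y| ≤ 1 + h y ^ 2 := by
      rw [← sq_abs]
      nlinarith [sq_nonneg (|h y| - 1), abs_nonneg (h y)]
    nlinarith [sq_nonneg (h y)]
  obtain ⟨c, hc⟩ := eq_add_integral_of_weak_deriv hR hχ.1 hh hw
  refine ⟨fun a ha => ?_, ?_, ?_⟩
  · have h1 := (hh a ha).absolutelyContinuousOnInterval_intervalIntegral (c := R) (by simp)
    have h2 : AbsolutelyContinuousOnInterval (fun _ : ℝ => c) a R :=
      contDiff_const.contDiffOn.absolutelyContinuousOnInterval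
    refine absolutelyContinuousOnInterval_congr (h2.fun_add h1) fun y hy => hc y ?_
    rw [uIcc_of_le ha.2] at hy
    exact ⟨ha.1.trans_le hy.1, hy.2⟩
  · have := hχ.2.1.integrable_sq
    exact (integrableOn_ball_radial m (f := fun y => χ y ^ 2)).1 this
  · rw [integrableOn_Ioc_iff_integrableOn_Ioo] at hi ⊢
    refine Integrable.congr hi ?_
    have hae : ∀ᵐ y : ℝ, y ∈ Ioo 0 R → HasDerivAt χ (h y) y := by
      -- Lebesgue differentiation is available only on intervals away from `0`; countably many of
      -- them exhaust `(0, R]`.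
      have h1 : ∀ᵐ y : ℝ, ∀ k : ℕ, y ∈ Ioc (R / (k + 2)) R →
          HasDerivAt (fun y => ∫ t in R..y, h t) (h y) y := by
        rw [ae_all_iff]
        intro k
        have hk : R / ((k : ℝ) + 2) ≤ R := div_le_self hR.le (by linarith [k.cast_nonneg (α := ℝ)])
        have hk0 : 0 < R / ((k : ℝ) + 2) := by positivity
        filter_upwards [(hh _ ⟨hk0, hk⟩).ae_hasDerivAt_integral] with y hy hy'
        exact hy (by rw [uIcc_of_le hk]; exact Ioc_subset_Icc_self hy') R (by simp)
      filter_upwards [h1] with y hy hy'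
      obtain ⟨k, hk⟩ := exists_nat_gt (R / y)
      have h2 : R / ((k : ℝ) + 2) < y := by
        rw [div_lt_iff₀ (by positivity)]
        rw [div_lt_iff₀ hy'.1] at hk
        nlinarith [hy'.1]
      refine ((hy k ⟨h2, hy'.2.le⟩).const_add c).congr_of_eventuallyEq ?_
      filter_upwards [isOpen_Ioo.mem_nhds hy'] with z hz
      exact hc z (Ioo_subset_Ioc_self hz)
    filter_upwards [ae_restrict_of_ae hae, ae_restrict_mem measurableSet_Ioo] with y hy hy'
    rw [(hy hy').deriv]

/-- A `C¹` even function of the radius is in `H¹`. -/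
theorem memH1r_of_hasDerivAt {n : ℕ} {R : ℝ} {φ ψ : ℝ → ℝ} (hφ : ∀ y, HasDerivAt φ (ψ y) y)
    (hψ : Continuous ψ) (hψ0 : ψ 0 = 0) : MemH1r n R φ := by
  have hφc : Continuous φ := continuous_iff_continuousAt.2 fun y => (hφ y).continuousAt
  have : IsFiniteMeasure (volume.restrict (B n R)) :=
    ⟨by rw [Measure.restrict_apply_univ]; exact measure_ball_lt_top⟩
  have hbd : ∀ {F : Type} [NormedAddCommGroup F] (f : EuclideanSpace ℝ (Fin n) → F),
      Continuous f → MemLp f 2 (volume.restrict (B n R)) := by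
    intro F _ f hf
    obtain ⟨C, hC⟩ := (isCompact_closedBall (0 : EuclideanSpace ℝ (Fin n)) R)
      |>.exists_bound_of_continuousOn hf.continuousOn
    refine MemLp.of_bound hf.aestronglyMeasurable C ?_
    filter_upwards [ae_restrict_mem measurableSet_ball] with x hx
    exact hC x (Metric.ball_subset_closedBall hx)
  -- The condition `ψ 0 = 0` makes this field continuous at the origin, so the gradient is classical
  -- there too.
  set g : EuclideanSpace ℝ (Fin n) → EuclideanSpace ℝ (Fin n) := fun x => (ψ ‖x‖ / ‖x‖) • x with hg
  have hgn : ∀ x, ‖g x‖ = |ψ ‖x‖| := by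
    intro x
    by_cases hx : x = 0
    · simp [hg, hx, hψ0]
    · have hx' : ‖x‖ ≠ 0 := norm_ne_zero_iff.2 hx
      simp only [hg, norm_smul, norm_div, Real.norm_eq_abs, abs_norm]
      field_simp
  have hgc : Continuous g := by
    refine continuous_iff_continuousAt.2 fun x => ?_
    by_cases hx : x = 0
    · subst hx
      have h0 : g 0 = 0 := by simp [hg]
      rw [ContinuousAt, h0, tendsto_zero_iff_norm_tendsto_zero]
      simp only [hgn]
      have : Continuous fun x : EuclideanSpace ℝ (Fin n) => |ψ ‖x‖| := by fun_prop
      simpa [hψ0] using this.tendsto (0 : EuclideanSpace ℝ (Fin n))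
    · have hx' : ‖x‖ ≠ 0 := norm_ne_zero_iff.2 hx
      exact ((hψ.comp continuous_norm).continuousAt.div continuous_norm.continuousAt hx').smul
        continuousAt_id
  have hfd : ∀ x, HasFDerivAt (fun x : EuclideanSpace ℝ (Fin n) => φ ‖x‖) (innerSL ℝ (g x)) x := by
    intro x
    by_cases hx : x = 0
    · subst hx
      have h0 : g 0 = 0 := by simp [hg]
      have h1 := hφ 0
      rw [hψ0, hasDerivAt_iff_isLittleO_nhds_zero] at h1
      rw [h0, hasFDerivAt_iff_isLittleO_nhds_zero]
      have h2 := h1.comp_tendsto (tendsto_norm_zero (E := EuclideanSpace ℝ (Fin n)))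
      have h3 := Asymptotics.isLittleO_norm_right.1 h2
      simpa [Function.comp_def] using h3
    · convert hasFDerivAt_comp_norm hx (hφ ‖x‖) using 1
      simp [hg]
  refine ⟨hφc.continuousOn, hbd _ (hφc.comp continuous_norm), g, hbd g hgc, ?_⟩
  intro θ h1 h2 h3 v
  have hθd : Continuous fun x => fderiv ℝ θ x v :=
    (h1.continuous_fderiv (by simp)).clm_apply continuous_const
  have hθs : HasCompactSupport fun x => fderiv ℝ θ x v := h2.fderiv_apply (𝕜 := ℝ) v
  have huc : Continuous fun x : EuclideanSpace ℝ (Fin n) => φ ‖x‖ := hφc.comp continuous_norm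
  have hfe : ∀ x, fderiv ℝ (fun x : EuclideanSpace ℝ (Fin n) => φ ‖x‖) x v = inner ℝ (g x) v :=
    fun x => by rw [(hfd x).fderiv]; simp
  have hgv : Continuous fun x => inner ℝ (g x) v := hgc.inner continuous_const
  have key := integral_mul_fderiv_eq_neg_fderiv_mul_of_integrable (μ := volume) (v := v)
    (f := fun x : EuclideanSpace ℝ (Fin n) => φ ‖x‖) (g := θ)
    (by simp only [hfe]; exact (hgv.mul h1.continuous).integrable_of_hasCompactSupport h2.mul_left)
    ((huc.mul hθd).integrable_of_hasCompactSupport hθs.mul_left)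
    ((huc.mul h1.continuous).integrable_of_hasCompactSupport h2.mul_left)
    (fun x _ => (hfd x).differentiableAt) (fun x _ => h1.differentiable (by simp) x)
  simp only [hfe] at key
  rw [setIntegral_eq_integral_of_forall_compl_eq_zero, key,
    setIntegral_eq_integral_of_forall_compl_eq_zero]
  · intro x hx
    rw [image_eq_zero_of_notMem_tsupport fun h => hx (h3 h), mul_zero]
  · intro x hx
    have : fderiv ℝ θ x = 0 := by
      by_contra hne
      exact hx (h3 (support_fderiv_subset ℝ hne))
    rw [this]
    simp

end WeakDerivative
-- The initial value problem at the regular singular point.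
section Volterra

/-- Coefficients of the equation `(P φ')' = e φ` on `(0, R]`, with a regular singular point
at `0`. -/
structure IsSingularPair (k : ℕ) (R : ℝ) (P e : ℝ → ℝ) : Prop where
  continuous_left : Continuous P
  continuous_right : Continuous e
  lower : ∃ c, 0 < c ∧ ∀ s ∈ Icc 0 R, c * s ^ k ≤ P s
  upper : ∃ C, 0 ≤ C ∧ ∀ s ∈ Icc 0 R, |e s| ≤ C * s ^ k

/-- The slope at `s` of a solution `F` of `(P F')' = e F`. -/
noncomputable def fluxSlope (P e F : ℝ → ℝ) (s : ℝ) : ℝ := (∫ t in (0 : ℝ)..s, e t * F t) / P s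

variable {k : ℕ} {R : ℝ} {P e : ℝ → ℝ}

theorem IsSingularPair.pos (h : IsSingularPair k R P e) {s : ℝ} (hs : s ∈ Ioc 0 R) : 0 < P s := by
  obtain ⟨c, hc, hP⟩ := h.lower
  exact (mul_pos hc (pow_pos hs.1 k)).trans_le (hP s ⟨hs.1.le, hs.2⟩)

theorem abs_flux_le {C A : ℝ} {j : ℕ} {F : ℝ → ℝ} (hC : 0 ≤ C) (hA : 0 ≤ A)
    (he : ∀ s ∈ Icc 0 R, |e s| ≤ C * s ^ k) (hF : ∀ s ∈ Icc 0 R, |F s| ≤ A * s ^ j)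
    {s : ℝ} (hs : s ∈ Icc 0 R) :
    |∫ t in (0 : ℝ)..s, e t * F t| ≤ C * A * s ^ (j + 1) * s ^ k := by
  have h1 : ∀ t ∈ uIoc 0 s, ‖e t * F t‖ ≤ C * s ^ k * (A * s ^ j) := by
    intro t ht
    rw [uIoc_of_le hs.1] at ht
    have ht' : t ∈ Icc 0 R := ⟨ht.1.le, ht.2.trans hs.2⟩
    rw [Real.norm_eq_abs, abs_mul]
    have h2 : t ^ k ≤ s ^ k := pow_le_pow_left₀ ht.1.le ht.2 k
    have h3 : t ^ j ≤ s ^ j := pow_le_pow_left₀ ht.1.le ht.2 j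
    refine mul_le_mul ((he t ht').trans (by gcongr)) ((hF t ht').trans (by gcongr)) (abs_nonneg _) ?_
    have := pow_nonneg hs.1 k
    positivity
  have h2 := intervalIntegral.norm_integral_le_of_norm_le_const h1
  rw [sub_zero, abs_of_nonneg hs.1, Real.norm_eq_abs] at h2
  calc _ ≤ _ := h2
    _ = _ := by ring

/-- The weight `s^k` in the bound for `e` cancels the one in the lower bound for `P`. The inner
integration leaves a gain of one power of `s`, so the singularity of `1/P` is harmless. -/
theorem abs_fluxSlope_le {c C A : ℝ} {j : ℕ} {F : ℝ → ℝ} (hc : 0 < c) (hC : 0 ≤ C) (hA : 0 ≤ A)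
    (hP : ∀ s ∈ Icc 0 R, c * s ^ k ≤ P s) (he : ∀ s ∈ Icc 0 R, |e s| ≤ C * s ^ k)
    (hF : ∀ s ∈ Icc 0 R, |F s| ≤ A * s ^ j) {s : ℝ} (hs : s ∈ Icc 0 R) :
    |fluxSlope P e F s| ≤ C / c * A * s ^ (j + 1) := by
  rcases hs.1.eq_or_lt with h0 | h0
  · simp [fluxSlope, ← h0]
  have hp : 0 < c * s ^ k := mul_pos hc (pow_pos h0 k)
  rw [fluxSlope, abs_div, abs_of_pos (hp.trans_le (hP s hs)), div_le_iff₀ (hp.trans_le (hP s hs))]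
  refine (abs_flux_le hC hA he hF hs).trans ?_
  have : C * A * s ^ (j + 1) * s ^ k = C / c * A * s ^ (j + 1) * (c * s ^ k) := by field_simp
  rw [this]
  have := pow_pos h0 (j + 1)
  gcongr
  exact hP s hs

theorem continuousOn_fluxSlope (h : IsSingularPair k R P e) {F : ℝ → ℝ} (hF : Continuous F) :
    ContinuousOn (fluxSlope P e F) (Icc 0 R) := by
  intro s hs
  rcases hs.1.eq_or_lt with h0 | h0
  · subst h0
    obtain ⟨c, hc, hP⟩ := h.lower
    obtain ⟨C, hC, he⟩ := h.upper
    obtain ⟨A, hA⟩ := (isCompact_Icc (a := (0 : ℝ)) (b := R)).exists_bound_of_continuousOn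
      hF.continuousOn
    have hA0 : 0 ≤ A := (norm_nonneg _).trans (hA 0 hs)
    have hb : ∀ s ∈ Icc 0 R, |fluxSlope P e F s| ≤ C / c * A * s ^ (0 + 1) := fun s hs =>
      abs_fluxSlope_le hc hC hA0 hP he (fun t ht => by simpa using hA t ht) hs
    have h00 : fluxSlope P e F 0 = 0 := by simp [fluxSlope]
    rw [ContinuousWithinAt, h00]
    refine squeeze_zero_norm' (a := fun s => C / c * A * s ^ (0 + 1)) ?_ ?_
    · filter_upwards [self_mem_nhdsWithin] with s hs
      exact hb s hs
    · have : Continuous fun s : ℝ => C / c * A * s ^ (0 + 1) := by fun_prop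
      simpa using (this.tendsto 0).mono_left nhdsWithin_le_nhds
  · have h1 : Continuous fun s => ∫ t in (0 : ℝ)..s, e t * F t :=
      intervalIntegral.continuous_primitive
        (fun a b => (h.continuous_right.mul hF).intervalIntegrable a b) 0
    exact (h1.continuousAt.div h.continuous_left.continuousAt (h.pos ⟨h0, hs.2⟩).ne').continuousWithinAt

theorem intervalIntegrable_fluxSlope (h : IsSingularPair k R P e) {F : ℝ → ℝ} (hF : Continuous F)
    {y : ℝ} (hy : y ∈ Icc 0 R) : IntervalIntegrable (fluxSlope P e F) volume 0 y := by
  refine ((continuousOn_fluxSlope h hF).mono ?_).intervalIntegrable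
  rw [uIcc_of_le hy.1]
  exact Icc_subset_Icc_right hy.2

theorem continuous_Icc_extend (hR : 0 ≤ R) (f : C(Icc (0 : ℝ) R, ℝ)) :
    Continuous (IccExtend hR f) := f.continuous.Icc_extend'

theorem fluxSlope_add (h : IsSingularPair k R P e) {F G : ℝ → ℝ} (hF : Continuous F)
    (hG : Continuous G) (s : ℝ) :
    fluxSlope P e (fun t => F t + G t) s = fluxSlope P e F s + fluxSlope P e G s := by
  have h1 := h.continuous_right
  simp only [fluxSlope, mul_add]
  rw [intervalIntegral.integral_add
    ((by fun_prop : Continuous fun t => e t * F t).intervalIntegrable _ _)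
    ((by fun_prop : Continuous fun t => e t * G t).intervalIntegrable _ _), add_div]

theorem fluxSlope_const_mul (a : ℝ) (F : ℝ → ℝ) (s : ℝ) :
    fluxSlope P e (fun t => a * F t) s = a * fluxSlope P e F s := by
  simp only [fluxSlope, mul_left_comm _ a]
  rw [intervalIntegral.integral_const_mul, mul_div_assoc]

theorem abs_integral_fluxSlope_le {c C A : ℝ} {j : ℕ} {F : ℝ → ℝ} (hc : 0 < c) (hC : 0 ≤ C)
    (hA : 0 ≤ A) (hP : ∀ s ∈ Icc 0 R, c * s ^ k ≤ P s) (he : ∀ s ∈ Icc 0 R, |e s| ≤ C * s ^ k)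
    (hF : ∀ s ∈ Icc 0 R, |F s| ≤ A * s ^ j) {y : ℝ} (hy : y ∈ Icc 0 R) :
    |∫ s in (0 : ℝ)..y, fluxSlope P e F s| ≤ C / c * A / (j + 2) * y ^ (j + 2) := by
  have h1 : ∀ᵐ s, s ∈ Ioc 0 y → ‖fluxSlope P e F s‖ ≤ C / c * A * s ^ (j + 1) :=
    .of_forall fun s hs => abs_fluxSlope_le hc hC hA hP he hF ⟨hs.1.le, hs.2.trans hy.2⟩
  have hi : IntervalIntegrable (fun s : ℝ => C / c * A * s ^ (j + 1)) volume 0 y :=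
    (by fun_prop : Continuous fun s : ℝ => C / c * A * s ^ (j + 1)).intervalIntegrable _ _
  have h2 := intervalIntegral.norm_integral_le_of_norm_le hy.1 h1 hi
  rw [intervalIntegral.integral_const_mul, integral_pow] at h2
  refine h2.trans (le_of_eq ?_)
  push_cast
  rw [zero_pow (by omega)]
  ring

theorem continuous_volterra (hR : 0 ≤ R) (h : IsSingularPair k R P e)
    (f : C(Icc (0 : ℝ) R, ℝ)) :
    Continuous fun y : Icc (0 : ℝ) R => ∫ s in (0 : ℝ)..y, fluxSlope P e (IccExtend hR f) s := by
  have h1 := intervalIntegral.continuousOn_primitive_interval (a := 0) (b := R)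
    (f := fluxSlope P e (IccExtend hR f)) (μ := volume) (by
      rw [uIcc_of_le hR]
      exact (continuousOn_fluxSlope h (continuous_Icc_extend hR f)).integrableOn_Icc)
  rw [uIcc_of_le hR] at h1
  exact continuousOn_iff_continuous_domRestrict.1 h1

theorem abs_IccExtend_le (hR : 0 ≤ R) (f : C(Icc (0 : ℝ) R, ℝ)) (s : ℝ) :
    |IccExtend hR f s| ≤ ‖f‖ := f.norm_coe_le_norm (projIcc 0 R hR s)

/-- The Volterra operator of the equation `(P φ')' = e φ` with regular singular point `0`. -/
noncomputable def volterra (hR : 0 ≤ R) (h : IsSingularPair k R P e) :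
    C(Icc (0 : ℝ) R, ℝ) →L[ℝ] C(Icc (0 : ℝ) R, ℝ) :=
  LinearMap.mkContinuousOfExistsBound
    { toFun := fun f => ⟨_, continuous_volterra hR h f⟩
      map_add' := fun f g => by
        ext y
        have : IccExtend hR (f + g : C(Icc (0 : ℝ) R, ℝ))
            = fun t => IccExtend hR f t + IccExtend hR g t := rfl
        simp only [this, ContinuousMap.coe_mk, ContinuousMap.add_apply]
        rw [← intervalIntegral.integral_add
          (intervalIntegrable_fluxSlope h (continuous_Icc_extend hR f) y.2)
          (intervalIntegrable_fluxSlope h (continuous_Icc_extend hR g) y.2)]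
        exact intervalIntegral.integral_congr fun s _ =>
          fluxSlope_add h (continuous_Icc_extend hR f) (continuous_Icc_extend hR g) s
      map_smul' := fun a f => by
        ext y
        have : IccExtend hR (a • f : C(Icc (0 : ℝ) R, ℝ))
            = fun t => a * IccExtend hR f t := rfl
        simp only [this, ContinuousMap.coe_mk, ContinuousMap.smul_apply, RingHom.id_apply,
          smul_eq_mul]
        rw [← intervalIntegral.integral_const_mul]
        exact intervalIntegral.integral_congr fun s _ => fluxSlope_const_mul a _ s }
    (by
      obtain ⟨c, hc, hP⟩ := h.lower
      obtain ⟨C, hC, he⟩ := h.upper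
      refine ⟨C / c / 2 * R ^ 2, fun f => ?_⟩
      refine (ContinuousMap.norm_le _ (by positivity)).2 fun y => ?_
      have := abs_integral_fluxSlope_le (j := 0) hc hC (norm_nonneg f) hP he
        (F := IccExtend hR f) (fun s _ => by simpa using abs_IccExtend_le hR f s) y.2
      refine this.trans ?_
      have h2 : (y : ℝ) ^ 2 ≤ R ^ 2 := pow_le_pow_left₀ y.2.1 y.2.2 2
      have h3 : 0 ≤ C / c * ‖f‖ / 2 := by positivity
      simp only [Nat.cast_zero, zero_add]
      nlinarith [mul_le_mul_of_nonneg_left h2 h3])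

theorem volterra_apply (hR : 0 ≤ R) (h : IsSingularPair k R P e) (f : C(Icc (0 : ℝ) R, ℝ))
    (y : Icc (0 : ℝ) R) :
    volterra hR h f y = ∫ s in (0 : ℝ)..y, fluxSlope P e (IccExtend hR f) s := rfl

/-- Each application gains `y²` and, from the outer integration, a factor `1 / (2n + 2)`. Only `1 /
(n + 1)` of it is kept, which already builds the factorial. -/
theorem abs_volterra_pow_le (hR : 0 ≤ R) (h : IsSingularPair k R P e) {c C : ℝ} (hc : 0 < c)
    (hC : 0 ≤ C) (hP : ∀ s ∈ Icc 0 R, c * s ^ k ≤ P s) (he : ∀ s ∈ Icc 0 R, |e s| ≤ C * s ^ k)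
    (f : C(Icc (0 : ℝ) R, ℝ)) (n : ℕ) (y : Icc (0 : ℝ) R) :
    |(volterra hR h ^ n) f y| ≤ (C / c) ^ n * ‖f‖ / n.factorial * (y : ℝ) ^ (2 * n) := by
  induction n generalizing y with
  | zero => simpa using f.norm_coe_le_norm y
  | succ n ih =>
    rw [pow_succ', mul_apply_eq_comp, volterra_apply]
    have := abs_integral_fluxSlope_le (j := 2 * n) (A := (C / c) ^ n * ‖f‖ / n.factorial) hc hC
      (by positivity) hP he (F := IccExtend hR ((volterra hR h ^ n) f)) (fun s hs => by
        rw [IccExtend_of_mem hR _ hs]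
        exact ih ⟨s, hs⟩) y.2
    refine this.trans ?_
    have hy : 0 ≤ (y : ℝ) ^ (2 * n + 2) := pow_nonneg y.2.1 _
    rw [show 2 * (n + 1) = 2 * n + 2 by ring]
    refine mul_le_mul_of_nonneg_right ?_ hy
    rw [Nat.factorial_succ, pow_succ]
    push_cast
    have e1 : C / c * ((C / c) ^ n * ‖f‖ / n.factorial) / (2 * (n : ℝ) + 2)
        = (C / c) ^ n * (C / c) * ‖f‖ / (((n : ℝ) + 1) * n.factorial) / 2 := by
      have : (n.factorial : ℝ) ≠ 0 := by positivity
      field_simp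
    rw [e1]
    exact half_le_self (by positivity)

/-- The factorial bound makes some power `K^n` have norm less than `1`, whatever the size of `K`. -/
theorem isUnit_one_sub_volterra (hR : 0 ≤ R) (h : IsSingularPair k R P e) :
    IsUnit (1 - volterra hR h) := by
  obtain ⟨c, hc, hP⟩ := h.lower
  obtain ⟨C, hC, he⟩ := h.upper
  have hb : ∀ n : ℕ, ‖volterra hR h ^ n‖ ≤ (C / c * R ^ 2) ^ n / n.factorial := by
    intro n
    refine ContinuousLinearMap.opNorm_le_bound _ (by positivity) fun f => ?_
    refine (ContinuousMap.norm_le _ (by positivity)).2 fun y => ?_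
    refine (abs_volterra_pow_le hR h hc hC hP he f n y).trans ?_
    have h1 : (y : ℝ) ^ (2 * n) ≤ R ^ (2 * n) := pow_le_pow_left₀ y.2.1 y.2.2 _
    calc _ ≤ (C / c) ^ n * ‖f‖ / n.factorial * R ^ (2 * n) := by gcongr
      _ = _ := by rw [mul_pow, ← pow_mul]; ring
  obtain ⟨n, hn⟩ := ((FloorSemiring.tendsto_pow_div_factorial_atTop (C / c * R ^ 2)).eventually
    (gt_mem_nhds one_pos)).exists
  have h1 : IsUnit (1 - volterra hR h ^ n) := 
    isUnit_one_sub_of_norm_lt_one (R := C(Icc (0 : ℝ) R, ℝ) →L[ℝ] C(Icc (0 : ℝ) R, ℝ))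
      ((hb n).trans_lt hn)
  -- `1 - K^n` is the product of `1 - K` with a finite geometric sum commuting with it, so
  -- invertibility passes to the factor.
  rw [← mul_neg_geom_sum] at h1
  have hcomm : Commute (1 - volterra hR h) (∑ i ∈ Finset.range n, volterra hR h ^ i) := by
    refine Commute.sum_right _ _ _ fun i _ => ?_
    exact ((Commute.one_left _).sub_left (Commute.refl _)).pow_right i
  exact (hcomm.isUnit_mul_iff.1 h1).1

/-- `φ`, with derivative `ψ`, is the solution of `(P φ')' = e φ` that is regular at `0`. -/
structure IsRegularSolution (R : ℝ) (P e φ ψ : ℝ → ℝ) : Prop where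
  hasDerivAt : ∀ y, HasDerivAt φ (ψ y) y
  continuous_deriv : Continuous ψ
  deriv_zero : ψ 0 = 0
  apply_zero : φ 0 = 1
  flux : ∀ y ∈ Icc 0 R, P y * ψ y = ∫ t in (0 : ℝ)..y, e t * φ t
  bound : ∃ C, 0 ≤ C ∧ ∀ y ∈ Icc 0 R, |ψ y| ≤ C * y

theorem IsRegularSolution.continuous {φ ψ : ℝ → ℝ} (h : IsRegularSolution R P e φ ψ) :
    Continuous φ := continuous_iff_continuousAt.2 fun y => (h.hasDerivAt y).continuousAt

theorem exists_isRegularSolution (hR : 0 < R) (h : IsSingularPair k R P e)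
    {f : C(Icc (0 : ℝ) R, ℝ)} (hf : f = 1 + volterra hR.le h f) :
    ∃ φ ψ : ℝ → ℝ, IsRegularSolution R P e φ ψ ∧ (∀ y : Icc (0 : ℝ) R, φ y = f y) := by
  set F := IccExtend hR.le f with hF
  have hFc : Continuous F := continuous_Icc_extend hR.le f
  -- The slope is continued by constants outside `[0, R]`, so that its primitive has a two-sided
  -- derivative at every point, the endpoints included.
  set ψ : ℝ → ℝ := IccExtend hR.le (domRestrict (Icc 0 R) (fluxSlope P e F)) with hψ
  have hψc : Continuous ψ :=
    (continuousOn_iff_continuous_domRestrict.1 (continuousOn_fluxSlope h hFc)).Icc_extend'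
  have hψs : ∀ y ∈ Icc 0 R, ψ y = fluxSlope P e F y := fun y hy => by
    rw [hψ, IccExtend_of_mem hR.le _ hy]
    rfl
  have hd : ∀ y, HasDerivAt (fun y => 1 + ∫ s in (0 : ℝ)..y, ψ s) (ψ y) y := fun y =>
    (hψc.integral_hasStrictDerivAt 0 y).hasDerivAt.const_add 1
  have hφf : ∀ y : Icc (0 : ℝ) R, 1 + ∫ s in (0 : ℝ)..y, ψ s = f y := by
    intro y
    conv_rhs => rw [hf]
    rw [ContinuousMap.add_apply, volterra_apply, ContinuousMap.one_apply]
    congr 1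
    refine intervalIntegral.integral_congr fun s hs => hψs s ?_
    rw [uIcc_of_le y.2.1] at hs
    exact ⟨hs.1, hs.2.trans y.2.2⟩
  have hφF : ∀ y ∈ Icc 0 R, 1 + ∫ s in (0 : ℝ)..y, ψ s = F y := fun y hy => by
    rw [hF, IccExtend_of_mem hR.le _ hy]
    exact hφf ⟨y, hy⟩
  refine ⟨fun y => 1 + ∫ s in (0 : ℝ)..y, ψ s, ψ, ⟨hd, hψc, ?_, by simp, fun y hy => ?_, ?_⟩, hφf⟩
  · rw [hψs 0 ⟨le_rfl, hR.le⟩]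
    simp [fluxSlope]
  · have h1 : ∫ t in (0 : ℝ)..y, e t * (1 + ∫ s in (0 : ℝ)..t, ψ s)
        = ∫ t in (0 : ℝ)..y, e t * F t := by
      refine intervalIntegral.integral_congr fun t ht => ?_
      rw [uIcc_of_le hy.1] at ht
      simp only [hφF t ⟨ht.1, ht.2.trans hy.2⟩]
    rw [h1, hψs y hy, fluxSlope]
    rcases hy.1.eq_or_lt with h0 | h0
    · simp [← h0]
    · exact mul_div_cancel₀ _ (h.pos ⟨h0, hy.2⟩).ne'
  · obtain ⟨c, hc, hP⟩ := h.lower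
    obtain ⟨C, hC, he⟩ := h.upper
    refine ⟨C / c * ‖f‖, by positivity, fun y hy => ?_⟩
    rw [hψs y hy]
    simpa using abs_fluxSlope_le (j := 0) hc hC (norm_nonneg f) hP he
      (F := F) (fun s _ => by simpa using abs_IccExtend_le hR.le f s) hy

/-- Regular solutions of `(P φ')' = (e - μ w) φ` depend continuously on `μ`. -/
theorem exists_isRegularSolution_family (hR : 0 < R) {w : ℝ → ℝ}
    (h : IsSingularPair k R P e) (hw : IsSingularPair k R P w)
    (hμ : ∀ μ : ℝ, IsSingularPair k R P (fun t => e t - μ * w t)) :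
    ∃ φ ψ : ℝ → ℝ → ℝ,
      (∀ μ, IsRegularSolution R P (fun t => e t - μ * w t) (φ μ) (ψ μ)) ∧
      (∀ μ₀, ∀ ε > 0, ∀ᶠ μ in nhds μ₀, ∀ y ∈ Icc 0 R, |φ μ y - φ μ₀ y| < ε) ∧
      Continuous fun μ => P R * ψ μ R := by
  set K : ℝ → (C(Icc (0 : ℝ) R, ℝ) →L[ℝ] C(Icc (0 : ℝ) R, ℝ)) := fun μ => volterra hR.le (hμ μ)
    with hK
  -- `K` is affine in `μ`. Inversion is continuous at units, so the fixed point `(1 - K μ)⁻¹ 1` is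
  -- continuous in `μ`.
  have hKc : Continuous K := by
    have : K = fun μ => volterra hR.le h - μ • volterra hR.le hw := by
      funext μ
      ext f y
      simp only [hK, sub_apply, smul_apply,
        ContinuousMap.sub_apply, ContinuousMap.smul_apply, volterra_apply, smul_eq_mul]
      have hf := continuous_Icc_extend hR.le f
      rw [← intervalIntegral.integral_const_mul, ← intervalIntegral.integral_sub
        (intervalIntegrable_fluxSlope h hf y.2) ((intervalIntegrable_fluxSlope hw hf y.2).const_mul μ)]
      refine intervalIntegral.integral_congr fun s _ => ?_
      simp only [fluxSlope, sub_mul, mul_assoc]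
      have h1 := h.continuous_right
      have h2 := hw.continuous_right
      rw [intervalIntegral.integral_sub
        ((by fun_prop : Continuous fun t => e t * IccExtend hR.le f t).intervalIntegrable _ _)
        ((by fun_prop : Continuous fun t => μ * (w t * IccExtend hR.le f t)).intervalIntegrable _ _),
        intervalIntegral.integral_const_mul]
      ring
    rw [this]
    fun_prop
  set f : ℝ → C(Icc (0 : ℝ) R, ℝ) := fun μ => Ring.inverse (1 - K μ) 1 with hf
  have hfix : ∀ μ, f μ = 1 + K μ (f μ) := by
    intro μ
    have h1 : (1 - K μ) * Ring.inverse (1 - K μ) = 1 :=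
      Ring.mul_inverse_cancel _ (isUnit_one_sub_volterra hR.le (hμ μ))
    have h2 := congrArg (fun T => T (1 : C(Icc (0 : ℝ) R, ℝ))) h1
    simp only [mul_apply_eq_comp, sub_apply,
      one_apply_eq_self] at h2
    exact sub_eq_iff_eq_add.1 h2
  have hfc : Continuous f := by
    refine continuous_iff_continuousAt.2 fun μ => ?_
    obtain ⟨u, hu⟩ := isUnit_one_sub_volterra hR.le (hμ μ)
    have h1 : ContinuousAt Ring.inverse (1 - K μ) := by
      rw [hK, ← hu]
      exact NormedRing.inverse_continuousAt
        (R := C(Icc (0 : ℝ) R, ℝ) →L[ℝ] C(Icc (0 : ℝ) R, ℝ)) u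
    have h2 : ContinuousAt (fun μ => Ring.inverse (1 - K μ)) μ :=
      ContinuousAt.comp (f := fun μ => 1 - K μ) h1 (continuous_const.sub hKc).continuousAt
    exact h2.clm_apply continuousAt_const
  choose φ ψ hφ hφf using fun μ => exists_isRegularSolution hR (hμ μ) (hfix μ)
  refine ⟨φ, ψ, hφ, fun μ₀ ε hε => ?_, ?_⟩
  · filter_upwards [Metric.tendsto_nhds.1 (hfc.tendsto μ₀) ε hε] with μ h1 y hy
    rw [hφf μ ⟨y, hy⟩, hφf μ₀ ⟨y, hy⟩]
    exact (ContinuousMap.dist_apply_le_dist _).trans_lt h1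
  · have hRR : R ∈ Icc 0 R := ⟨hR.le, le_rfl⟩
    have h1 : (fun μ => P R * ψ μ R)
        = fun μ => ∫ t in (0 : ℝ)..R, (e t - μ * w t) * f μ (projIcc 0 R hR.le t) := by
      funext μ
      rw [(hφ μ).flux R hRR]
      refine intervalIntegral.integral_congr fun t ht => ?_
      rw [uIcc_of_le hR.le] at ht
      simp only [projIcc_of_mem hR.le ht]
      rw [← hφf μ ⟨t, ht⟩]
    rw [h1]
    refine intervalIntegral.continuous_parametric_intervalIntegral_of_continuous' ?_ 0 R
    have := h.continuous_right
    have := hw.continuous_right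
    have hp : Continuous (projIcc 0 R hR.le) := continuous_projIcc
    simp only [Function.uncurry_def]
    fun_prop

end Volterra
end LaneEmden

open Filter Topology

namespace LaneEmden

/-! ### Picone's inequality and the energy identity on `(0, R]`. -/

section Energy

/-- Otherwise `h ≥ ε / y` near `0`, and `1 / y` would be integrable there. -/
theorem frequently_mul_lt_of_integrableOn {R : ℝ} (hR : 0 < R) {h : ℝ → ℝ}
    (hi : IntegrableOn h (Ioc 0 R)) {ε : ℝ} (hε : 0 < ε) :
    ∃ᶠ y in 𝓝[>] (0 : ℝ), y * h y < ε := by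
  intro hev
  obtain ⟨δ, hδ, hsub⟩ := mem_nhdsGT_iff_exists_Ioc_subset.1 hev
  have hδ0 : (0 : ℝ) < δ := hδ
  set r := min δ R with hr
  have hr0 : 0 < r := lt_min hδ0 hR
  have h1 : IntegrableOn (fun y : ℝ => y⁻¹) (Ioc 0 r) := by
    have h2 : IntegrableOn (fun y => ε⁻¹ * h y) (Ioc 0 r) :=
      (hi.mono_set (Ioc_subset_Ioc_right (min_le_right _ _))).const_mul _
    refine Integrable.mono' h2 measurable_inv.aestronglyMeasurable ?_
    filter_upwards [ae_restrict_mem measurableSet_Ioc] with y hy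
    have h3 : ¬ y * h y < ε := hsub ⟨hy.1, hy.2.trans (min_le_left _ _)⟩
    have hy0 : 0 < y := hy.1
    rw [Real.norm_eq_abs, abs_of_pos (inv_pos.2 hy0), inv_mul_eq_div, le_div_iff₀ hε,
      inv_mul_le_iff₀ hy0]
    exact not_lt.1 h3
  have h4 : IntervalIntegrable (fun y : ℝ => y⁻¹) volume 0 r := by
    rwa [intervalIntegrable_iff_integrableOn_Ioc_of_le hr0.le]
  rw [intervalIntegrable_inv_iff] at h4
  rcases h4 with h4 | h4
  · exact hr0.ne h4
  · exact h4 (by simp)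

/-- The integral over `(a, R)` converges as `a → 0`, so the boundary term `G a` need only be small
along a sequence; it is not required to have a limit. -/
theorem le_integral_of_frequently_small {R : ℝ} (hR : 0 < R) {g G : ℝ → ℝ} {c : ℝ}
    (hg : IntegrableOn g (Ioc 0 R)) (h : ∀ a ∈ Ioo 0 R, c - G a ≤ ∫ y in a..R, g y)
    (hG : ∀ ε > 0, ∃ᶠ a in 𝓝[>] (0 : ℝ), G a < ε) : c ≤ ∫ y in (0 : ℝ)..R, g y := by
  have hgi : IntervalIntegrable g volume 0 R :=
    (intervalIntegrable_iff_integrableOn_Ioc_of_le hR.le).2 hg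
  have ht : Tendsto (fun a => ∫ y in a..R, g y) (𝓝[>] 0) (𝓝 (∫ y in (0 : ℝ)..R, g y)) := by
    have h1 := intervalIntegral.continuousOn_primitive_interval_left (a := 0) (b := R) (f := g)
      (μ := volume) (by
        rw [uIcc_of_le hR.le, integrableOn_Icc_iff_integrableOn_Ioc]; exact hg)
    have h2 := h1 0 (by simp)
    refine h2.mono_left (nhdsWithin_le_iff.2 ?_)
    rw [uIcc_of_le hR.le]
    exact mem_of_superset (Ioc_mem_nhdsGT hR) Ioc_subset_Icc_self
  refine le_of_forall_pos_le_add fun ε hε => ?_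
  have h1 : ∀ᶠ a in 𝓝[>] (0 : ℝ), (∫ y in a..R, g y) < (∫ y in (0 : ℝ)..R, g y) + ε / 2 :=
    ht.eventually (gt_mem_nhds (by linarith))
  obtain ⟨a, ha, ha1, ha2⟩ := ((hG (ε / 2) (by linarith)).and_eventually
    (h1.and (Ioo_mem_nhdsGT hR))).exists
  have := h a ha2
  linarith [ha1]

variable {k : ℕ} {R : ℝ} {P e χ : ℝ → ℝ}

theorem IsRadialProfile.continuousOn (hχ : IsRadialProfile k R χ) : ContinuousOn χ (Ioc 0 R) := by
  intro y hy
  have h1 := (hχ.ac (y / 2) ⟨by linarith [hy.1], by linarith [hy.1, hy.2]⟩).continuousOn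
  rw [uIcc_of_le (by linarith [hy.1, hy.2])] at h1
  refine (h1 y ⟨by linarith [hy.1], hy.2⟩).mono_of_mem_nhdsWithin ?_
  filter_upwards [self_mem_nhdsWithin, mem_nhdsWithin_of_mem_nhds
    (Ioi_mem_nhds (show y / 2 < y by linarith [hy.1]))] with z hz hz'
  exact ⟨le_of_lt hz', hz.2⟩

theorem integrableOn_mul_of_abs_le {C : ℝ} {q v : ℝ → ℝ} (hq : Continuous q)
    (hqb : ∀ s ∈ Icc 0 R, |q s| ≤ C * s ^ k) (hvm : AEStronglyMeasurable v (volume.restrict (Ioc 0 R)))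
    (hv : IntegrableOn (fun y => y ^ k * v y ^ 2) (Ioc 0 R)) :
    IntegrableOn (fun y => q y * v y ^ 2) (Ioc 0 R) := by
  refine Integrable.mono' (hv.const_mul C) (hq.aestronglyMeasurable.mul (hvm.pow 2)) ?_
  filter_upwards [ae_restrict_mem measurableSet_Ioc] with y hy
  rw [Real.norm_eq_abs, abs_mul, abs_of_nonneg (sq_nonneg (v y)), ← mul_assoc]
  exact mul_le_mul_of_nonneg_right (hqb y (Ioc_subset_Icc_self hy)) (sq_nonneg _)

theorem IsRadialProfile.integrableOn_weight (hχ : IsRadialProfile k R χ) {C : ℝ} {q : ℝ → ℝ}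
    (hq : Continuous q) (hqb : ∀ s ∈ Icc 0 R, |q s| ≤ C * s ^ k) :
    IntegrableOn (fun y => q y * χ y ^ 2) (Ioc 0 R) :=
  integrableOn_mul_of_abs_le hq hqb (hχ.continuousOn.aestronglyMeasurable measurableSet_Ioc)
    hχ.integrableOn_sq

theorem IsRadialProfile.integrableOn_energy (hχ : IsRadialProfile k R χ)
    (h : IsSingularPair k R P e) {C : ℝ} (hPu : ∀ s ∈ Icc 0 R, |P s| ≤ C * s ^ k) :
    IntegrableOn (fun y => P y * deriv χ y ^ 2 + e y * χ y ^ 2) (Ioc 0 R) := by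
  obtain ⟨C', -, he⟩ := h.upper
  exact (integrableOn_mul_of_abs_le h.continuous_left hPu
    (measurable_deriv χ).aestronglyMeasurable hχ.integrableOn_deriv_sq).add
    (hχ.integrableOn_weight h.continuous_right he)

/-- Picone's inequality for a positive regular solution. -/
theorem IsRegularSolution.picone (hR : 0 < R) (h : IsSingularPair k R P e) {C : ℝ}
    (hPu : ∀ s ∈ Icc 0 R, |P s| ≤ C * s ^ k) {φ ψ : ℝ → ℝ} (hφ : IsRegularSolution R P e φ ψ)
    (hpos : ∀ y ∈ Icc 0 R, 0 < φ y) (hχ : IsRadialProfile k R χ) :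
    χ R ^ 2 * (P R * ψ R / φ R)
      ≤ ∫ y in (0 : ℝ)..R, (P y * deriv χ y ^ 2 + e y * χ y ^ 2) := by
  -- The flux `P ψ` is replaced by its integral `J`, which is `C¹` on the whole line, whereas
  -- neither `P` nor `ψ` is assumed differentiable.
  set J : ℝ → ℝ := fun y => ∫ t in (0 : ℝ)..y, e t * φ t with hJ
  have hec : Continuous fun t => e t * φ t := h.continuous_right.mul hφ.continuous
  have hJd : ∀ y, HasDerivAt J (e y * φ y) y := fun y =>
    (hec.integral_hasStrictDerivAt 0 y).hasDerivAt
  have hJ1 : ContDiff ℝ 1 J := contDiff_one_iff_deriv.2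
    ⟨fun y => (hJd y).differentiableAt, by
      rw [show deriv J = fun y => e y * φ y from funext fun y => (hJd y).deriv]; exact hec⟩
  have hφ1 : ContDiff ℝ 1 φ := contDiff_one_iff_deriv.2
    ⟨fun y => (hφ.hasDerivAt y).differentiableAt, by
      rw [show deriv φ = ψ from funext fun y => (hφ.hasDerivAt y).deriv]
      exact hφ.continuous_deriv⟩
  have hflux : ∀ y ∈ Icc 0 R, P y * ψ y = J y := hφ.flux
  set G : ℝ → ℝ := fun a => χ a * χ a * (J a / φ a) with hG
  have hGR : χ R ^ 2 * (P R * ψ R / φ R) = G R := by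
    rw [hflux R ⟨hR.le, le_rfl⟩, hG]
    ring
  rw [hGR]
  refine le_integral_of_frequently_small hR (hχ.integrableOn_energy h hPu) (G := G)
    (fun a ha => ?_) fun ε hε => ?_
  · have hVac : AbsolutelyContinuousOnInterval (fun y => J y / φ y) a R := by
      refine ContDiffOn.absolutelyContinuousOnInterval ?_
      refine hJ1.contDiffOn.div hφ1.contDiffOn fun y hy => ?_
      rw [uIcc_of_le ha.2.le] at hy
      exact (hpos y ⟨ha.1.le.trans hy.1, hy.2⟩).ne'
    have hχac := hχ.ac a ⟨ha.1, ha.2.le⟩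
    have hGac : AbsolutelyContinuousOnInterval G a R := (hχac.fun_mul hχac).fun_mul hVac
    rw [← hGac.integral_deriv_eq_sub]
    refine intervalIntegral.integral_mono_ae_restrict ha.2.le hGac.intervalIntegrable_deriv ?_ ?_
    · rw [intervalIntegrable_iff_integrableOn_Ioc_of_le ha.2.le]
      exact (hχ.integrableOn_energy h hPu).mono_set (Ioc_subset_Ioc_left ha.1.le)
    · rw [Filter.EventuallyLE, ae_restrict_iff' measurableSet_Icc]
      filter_upwards [hχac.ae_differentiableAt] with y hy hyI
      have hyR : y ∈ Icc 0 R := ⟨ha.1.le.trans hyI.1, hyI.2⟩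
      have hφy := hpos y hyR
      have hχd := (hy (by rwa [uIcc_of_le ha.2.le])).hasDerivAt
      have hd := ((hχd.mul hχd).mul ((hJd y).div (hφ.hasDerivAt y) hφy.ne'))
      have hd' : HasDerivAt G _ y := hd
      rw [hd'.deriv]
      simp only [Pi.mul_apply, Pi.div_apply]
      rw [← hflux y hyR]
      have hPy := h.pos (s := y) ⟨ha.1.trans_le hyI.1, hyI.2⟩
      -- This square is exactly the difference between the integrand and the derivative of `G`.
      have hsq : 0 ≤ P y * (deriv χ y - χ y * ψ y / φ y) ^ 2 := by positivity
      have hid : P y * deriv χ y ^ 2 + e y * χ y ^ 2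
          = ((deriv χ y * χ y + χ y * deriv χ y) * (P y * ψ y / φ y)
            + χ y * χ y * ((e y * φ y * φ y - P y * ψ y * ψ y) / φ y ^ 2))
            + P y * (deriv χ y - χ y * ψ y / φ y) ^ 2 := by
        field_simp
        ring
      rw [hid]
      linarith
  -- Near `0` the flux is `O(a^(k+1))`, so `G a` is at most a constant times `a · a^k χ(a)²`, which
  -- is small along a sequence because `y^k χ²` is integrable.
  · obtain ⟨C', hC', hψ⟩ := hφ.bound
    obtain ⟨y₀, hy₀, hmin⟩ := (isCompact_Icc (a := (0 : ℝ)) (b := R)).exists_isMinOn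
      ⟨0, le_rfl, hR.le⟩ hφ.continuous.continuousOn
    have hm := hpos y₀ hy₀
    have hC : 0 ≤ C := by
      have h1 := hPu R ⟨hR.le, le_rfl⟩
      have h2 := (abs_nonneg _).trans h1
      exact nonneg_of_mul_nonneg_left h2 (pow_pos hR k)
    set D := C * C' / φ y₀ + 1 with hD
    have hDpos : 0 < D := by positivity
    have hfr := frequently_mul_lt_of_integrableOn hR hχ.integrableOn_sq (div_pos hε hDpos)
    refine (hfr.and_eventually (Ioo_mem_nhdsGT hR)).mono fun a ha => ?_
    obtain ⟨ha1, ha2⟩ := ha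
    have haI : a ∈ Icc 0 R := Ioo_subset_Icc_self ha2
    rw [lt_div_iff₀ hDpos] at ha1
    have hak : 0 ≤ a ^ k := pow_nonneg haI.1 k
    have hJa : J a ≤ C * a ^ k * (C' * a) := by
      rw [← hflux a haI]
      refine (le_abs_self _).trans ?_
      rw [abs_mul]
      exact mul_le_mul (hPu a haI) (hψ a haI) (abs_nonneg _) (by positivity)
    have h1 : J a / φ a ≤ C * a ^ k * (C' * a) / φ y₀ := by
      have h2 : φ y₀ ≤ φ a := hmin haI
      calc J a / φ a ≤ C * a ^ k * (C' * a) / φ a :=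
            div_le_div_of_nonneg_right hJa (hpos a haI).le
        _ ≤ _ := by
            have : 0 ≤ C * a ^ k * (C' * a) := mul_nonneg (by positivity) (mul_nonneg hC' haI.1)
            gcongr
    calc G a ≤ χ a * χ a * (C * a ^ k * (C' * a) / φ y₀) :=
          mul_le_mul_of_nonneg_left h1 (mul_self_nonneg _)
      _ = a * (a ^ k * χ a ^ 2) * (C * C' / φ y₀) := by ring
      _ ≤ a * (a ^ k * χ a ^ 2) * D := by
          refine mul_le_mul_of_nonneg_left (by rw [hD]; linarith) ?_
          exact mul_nonneg haI.1 (mul_nonneg hak (sq_nonneg _))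
      _ < ε := ha1

/-- A Hardy-type bound at the origin: `y^(d+1) χ'² + (y^d χ²)'` equals `y^(d-1) (χ + y χ')² + (d-1)
y^(d-1) χ²`, hence is nonnegative, and is integrated from `a` to `R`. -/
theorem IsRadialProfile.pow_mul_sq_le {d : ℕ} (hd : 1 ≤ d)
    (hχ : IsRadialProfile (d + 1) R χ) {a : ℝ} (ha : a ∈ Ioo 0 R) :
    a ^ d * χ a ^ 2
      ≤ R ^ d * χ R ^ 2 + ∫ y in (0 : ℝ)..R, y ^ (d + 1) * deriv χ y ^ 2 := by
  have hR : 0 < R := ha.1.trans ha.2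
  have hχac := hχ.ac a ⟨ha.1, ha.2.le⟩
  have hpac : AbsolutelyContinuousOnInterval (fun y : ℝ => y ^ d) a R :=
    (contDiff_id.pow d : ContDiff ℝ 1 fun y : ℝ => y ^ d).contDiffOn.absolutelyContinuousOnInterval
  set N : ℝ → ℝ := fun y => -(y ^ d * (χ y * χ y)) with hN
  have hNac : AbsolutelyContinuousOnInterval N a R := (hpac.fun_mul (hχac.fun_mul hχac)).fun_neg
  have hii : IntegrableOn (fun y => y ^ (d + 1) * deriv χ y ^ 2) (Ioc a R) :=
    hχ.integrableOn_deriv_sq.mono_set (Ioc_subset_Ioc_left ha.1.le)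
  have h1 : ∫ y in a..R, deriv N y ≤ ∫ y in a..R, y ^ (d + 1) * deriv χ y ^ 2 := by
    refine intervalIntegral.integral_mono_ae_restrict ha.2.le hNac.intervalIntegrable_deriv
      ((intervalIntegrable_iff_integrableOn_Ioc_of_le ha.2.le).2 hii) ?_
    rw [Filter.EventuallyLE, ae_restrict_iff' measurableSet_Icc]
    filter_upwards [hχac.ae_differentiableAt] with y hy hyI
    have hχd := (hy (by rwa [uIcc_of_le ha.2.le])).hasDerivAt
    have hd' : HasDerivAt N _ y := ((hasDerivAt_pow d y).mul (hχd.mul hχd)).neg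
    rw [hd'.deriv]
    simp only [Pi.mul_apply]
    have hy0 : 0 < y := ha.1.trans_le hyI.1
    obtain ⟨j, rfl⟩ : ∃ j, d = j + 1 := ⟨d - 1, by omega⟩
    have hyj : 0 ≤ y ^ j := (pow_pos hy0 j).le
    have hs1 : 0 ≤ y ^ j * (χ y + y * deriv χ y) ^ 2 := by positivity
    have hs2 : 0 ≤ (j : ℝ) * (y ^ j * χ y ^ 2) := by positivity
    simp only [Nat.add_sub_cancel]
    push_cast
    have : y ^ (j + 1 + 1) * deriv χ y ^ 2
        - -(((j : ℝ) + 1) * y ^ j * (χ y * χ y)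
          + y ^ (j + 1) * (deriv χ y * χ y + χ y * deriv χ y))
        = y ^ j * (χ y + y * deriv χ y) ^ 2 + (j : ℝ) * (y ^ j * χ y ^ 2) := by ring
    linarith
  have h2 : ∫ y in a..R, y ^ (d + 1) * deriv χ y ^ 2
      ≤ ∫ y in (0 : ℝ)..R, y ^ (d + 1) * deriv χ y ^ 2 := by
    rw [intervalIntegral.integral_of_le ha.2.le, intervalIntegral.integral_of_le hR.le]
    refine setIntegral_mono_set hχ.integrableOn_deriv_sq ?_
      (Ioc_subset_Ioc_left ha.1.le).eventuallyLE
    filter_upwards [ae_restrict_mem measurableSet_Ioc] with y hy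
    have := pow_pos hy.1 (d + 1)
    positivity
  rw [hNac.integral_deriv_eq_sub] at h1
  simp only [hN] at h1
  nlinarith

/-- The energy identity for classical solutions of `(P χ')' = e χ` of finite energy. -/
theorem IsRadialProfile.energy_identity {d : ℕ} (hd : 1 ≤ d) (hR : 0 < R)
    (h : IsSingularPair (d + 1) R P e) {C : ℝ} (hPu : ∀ s ∈ Icc 0 R, |P s| ≤ C * s ^ (d + 1))
    (hχ : IsRadialProfile (d + 1) R χ) {θ : ℝ → ℝ} (hθc : ContinuousOn θ (Ioc 0 R))
    (hθ : ∀ y ∈ Ioo 0 R, HasDerivAt χ (θ y) y)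
    (hode : ∀ y ∈ Ioo 0 R, HasDerivAt (fun s => P s * θ s) (e y * χ y) y) :
    ∫ y in (0 : ℝ)..R, (P y * deriv χ y ^ 2 + e y * χ y ^ 2) = P R * θ R * χ R := by
  set G : ℝ → ℝ := fun a => P a * θ a * χ a with hG
  have hint := hχ.integrableOn_energy h hPu
  have hparts : ∀ a ∈ Ioo 0 R,
      ∫ y in a..R, (P y * deriv χ y ^ 2 + e y * χ y ^ 2) = G R - G a := by
    intro a ha
    have hsub : Icc a R ⊆ Ioc 0 R := fun y hy => ⟨ha.1.trans_le hy.1, hy.2⟩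
    refine intervalIntegral.integral_eq_sub_of_hasDerivAt_of_le ha.2.le ?_ (fun y hy => ?_) ?_
    · exact (h.continuous_left.continuousOn.mul (hθc.mono hsub)).mul (hχ.continuousOn.mono hsub)
    · have hy' : y ∈ Ioo 0 R := ⟨ha.1.trans hy.1, hy.2⟩
      refine ((hode y hy').mul (hθ y hy')).congr_deriv ?_
      rw [(hθ y hy').deriv]
      ring
    · rw [intervalIntegrable_iff_integrableOn_Ioc_of_le ha.2.le]
      exact hint.mono_set (Ioc_subset_Ioc_left ha.1.le)
  -- `G a ²` is at most `C²` times the product of `a^d χ²`, bounded by the Hardy-type estimate, and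
  -- `a · a^(d+1) χ'²`, small along a sequence. No regularity of `χ` at `0` is needed.
  have hsmall : ∀ ε > 0, ∃ᶠ a in 𝓝[>] (0 : ℝ), |G a| < ε := by
    intro ε hε
    set M := R ^ d * χ R ^ 2 + ∫ y in (0 : ℝ)..R, y ^ (d + 1) * deriv χ y ^ 2 with hM
    have hM0 : 0 ≤ M := by
      have := hχ.pow_mul_sq_le hd (a := R / 2) ⟨by linarith, by linarith⟩
      refine le_trans ?_ this
      positivity
    set D := C ^ 2 * M + 1 with hD
    have hDpos : 0 < D := by positivity
    have hfr := frequently_mul_lt_of_integrableOn hR hχ.integrableOn_deriv_sq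
      (div_pos (pow_pos hε 2) hDpos)
    refine (hfr.and_eventually (Ioo_mem_nhdsGT hR)).mono fun a ha => ?_
    obtain ⟨ha1, ha2⟩ := ha
    have haI : a ∈ Icc 0 R := Ioo_subset_Icc_self ha2
    rw [lt_div_iff₀ hDpos, (hθ a ha2).deriv] at ha1
    have hb := hχ.pow_mul_sq_le hd ha2
    rw [← hM] at hb
    refine abs_lt_of_sq_lt_sq ?_ hε.le
    have hP2 : P a ^ 2 ≤ (C * a ^ (d + 1)) ^ 2 := by
      rw [← sq_abs]
      exact pow_le_pow_left₀ (abs_nonneg _) (hPu a haI) 2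
    have hT : 0 ≤ a * (a ^ (d + 1) * θ a ^ 2) := by
      have := pow_nonneg haI.1 (d + 1)
      exact mul_nonneg haI.1 (mul_nonneg this (sq_nonneg _))
    calc G a ^ 2 = P a ^ 2 * (θ a ^ 2 * χ a ^ 2) := by simp only [hG]; ring
      _ ≤ (C * a ^ (d + 1)) ^ 2 * (θ a ^ 2 * χ a ^ 2) :=
          mul_le_mul_of_nonneg_right hP2 (by positivity)
      _ = C ^ 2 * (a ^ d * χ a ^ 2) * (a * (a ^ (d + 1) * θ a ^ 2)) := by ring
      _ ≤ C ^ 2 * M * (a * (a ^ (d + 1) * θ a ^ 2)) := by gcongr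
      _ ≤ D * (a * (a ^ (d + 1) * θ a ^ 2)) :=
          mul_le_mul_of_nonneg_right (by rw [hD]; linarith) hT
      _ < ε ^ 2 := by linarith
  refine le_antisymm ?_ ?_
  · have := le_integral_of_frequently_small hR hint.neg (c := -G R) (G := fun a => -G a)
      (fun a ha => by
        simp only [Pi.neg_apply]
        rw [intervalIntegral.integral_neg, hparts a ha]
        linarith)
      fun ε hε => (hsmall ε hε).mono fun a ha => by linarith [neg_abs_le (G a)]
    simp only [Pi.neg_apply] at this
    rw [intervalIntegral.integral_neg] at this
    linarith
  · exact le_integral_of_frequently_small hR hint (G := G) (fun a ha => (hparts a ha).ge)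
      fun ε hε => (hsmall ε hε).mono fun a ha => by linarith [le_abs_self (G a)]

end Energy
-- Shooting for a positive solution with the Robin condition.
section GroundState

variable {k : ℕ} {R : ℝ} {P e φ ψ : ℝ → ℝ}

/-- Uniqueness for the Cauchy problem at a regular point. -/
theorem IsRegularSolution.false_of_cauchy_zero (h : IsSingularPair k R P e)
    (hφ : IsRegularSolution R P e φ ψ) {b : ℝ} (hb : b ∈ Ioc 0 R) (h0 : φ b = 0)
    (h1 : ψ b = 0) : False := by
  set J : ℝ → ℝ := fun y => ∫ t in (0 : ℝ)..y, e t * φ t with hJ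
  have hec : Continuous fun t => e t * φ t := h.continuous_right.mul hφ.continuous
  have hJd : ∀ y, HasDerivAt J (e y * φ y) y := fun y =>
    (hec.integral_hasStrictDerivAt 0 y).hasDerivAt
  have hflux : ∀ y ∈ Icc 0 R, P y * ψ y = J y := hφ.flux
  have hzero : EqOn φ (fun _ => 0) (Ioo 0 b) := by
    intro a ha
    have hIcc : ∀ y ∈ Icc a b, y ∈ Ioc 0 R := fun y hy =>
      ⟨ha.1.trans_le hy.1, hy.2.trans hb.2⟩
    have hcont : ContinuousOn (fun y => (P y)⁻¹ + e y) (Icc a b) :=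
      (h.continuous_left.continuousOn.inv₀ fun y hy => (h.pos (hIcc y hy)).ne').add
        h.continuous_right.continuousOn
    obtain ⟨M, hM⟩ := isCompact_Icc.exists_bound_of_continuousOn hcont
    -- A backward Grönwall argument: `M` bounds `1/P + e` on `[a, b]`, so `N` is nondecreasing
    -- there. Since `N b = 0`, `φ` vanishes on all of `(0, b)`, against `φ 0 = 1`.
    set N : ℝ → ℝ := fun y => (φ y ^ 2 + J y ^ 2) * Real.exp (M * y) with hN
    have hNd : ∀ y, HasDerivAt N ((2 * φ y * ψ y + 2 * J y * (e y * φ y)) * Real.exp (M * y)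
        + (φ y ^ 2 + J y ^ 2) * (Real.exp (M * y) * M)) y := by
      intro y
      have h2 : HasDerivAt (fun y => φ y ^ 2 + J y ^ 2)
          (2 * φ y * ψ y + 2 * J y * (e y * φ y)) y := by
        refine (((hφ.hasDerivAt y).pow 2).add ((hJd y).pow 2)).congr_deriv ?_
        simp
      have h3 : HasDerivAt (fun y => Real.exp (M * y)) (Real.exp (M * y) * M) y := by
        simpa using ((hasDerivAt_id y).const_mul M).exp
      exact h2.mul h3
    have hmono : MonotoneOn N (Icc a b) := by
      refine monotoneOn_of_deriv_nonneg (convex_Icc a b)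
        (fun y _ => (hNd y).continuousAt.continuousWithinAt)
        (fun y _ => (hNd y).differentiableAt.differentiableWithinAt) fun y hy => ?_
      rw [interior_Icc] at hy
      have hyI := hIcc y (Ioo_subset_Icc_self hy)
      have hPy := h.pos hyI
      rw [(hNd y).deriv]
      have hψ : ψ y = (P y)⁻¹ * J y := by
        rw [← hflux y (Ioc_subset_Icc_self hyI), inv_mul_cancel_left₀ hPy.ne']
      have e1 : (2 * φ y * ψ y + 2 * J y * (e y * φ y)) * Real.exp (M * y)
          + (φ y ^ 2 + J y ^ 2) * (Real.exp (M * y) * M)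
          = (2 * (φ y * J y) * ((P y)⁻¹ + e y) + M * (φ y ^ 2 + J y ^ 2))
            * Real.exp (M * y) := by
        rw [hψ]
        ring
      rw [e1]
      refine mul_nonneg ?_ (Real.exp_pos _).le
      have hMy := abs_le.1 (hM y (Ioo_subset_Icc_self hy))
      have hM0 : 0 ≤ M := (norm_nonneg _).trans (hM y (Ioo_subset_Icc_self hy))
      nlinarith [mul_nonneg (sub_nonneg.2 hMy.2) (sq_nonneg (φ y - J y)),
        mul_nonneg (sub_nonneg.2 hMy.1) (sq_nonneg (φ y + J y))]
    have hle := hmono ⟨le_rfl, ha.2.le⟩ ⟨ha.2.le, le_rfl⟩ ha.2.le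
    have hJb : J b = 0 := by rw [← hflux b (Ioc_subset_Icc_self hb), h1, mul_zero]
    simp only [hN, h0, hJb] at hle
    have hexp := Real.exp_pos (M * a)
    have : φ a ^ 2 + J a ^ 2 ≤ 0 := by
      by_contra hlt
      have := mul_pos (not_le.1 hlt) hexp
      simp at hle
      linarith
    have h4 : φ a ^ 2 = 0 := by nlinarith [sq_nonneg (φ a), sq_nonneg (J a)]
    exact pow_eq_zero_iff (two_ne_zero) |>.1 h4
  have hcl := hzero.closure hφ.continuous continuous_const
  rw [closure_Ioo hb.1.ne] at hcl
  have := hcl ⟨le_rfl, hb.1.le⟩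
  rw [hφ.apply_zero] at this
  exact one_ne_zero this

/-- A nonnegative regular solution is positive, if it satisfies a Robin inequality at `R`. -/
theorem IsRegularSolution.pos_of_nonneg (hR : 0 < R) (h : IsSingularPair k R P e)
    (hφ : IsRegularSolution R P e φ ψ) (hnn : ∀ y ∈ Icc 0 R, 0 ≤ φ y) {β : ℝ}
    (hrob : 0 ≤ P R * ψ R + β * φ R) : ∀ y ∈ Icc 0 R, 0 < φ y := by
  intro y hy
  refine lt_of_le_of_ne (hnn y hy) fun h0 => ?_
  rcases hy.1.eq_or_lt with hy0 | hy0
  · rw [← hy0, hφ.apply_zero] at h0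
    exact zero_ne_one h0
  refine hφ.false_of_cauchy_zero h ⟨hy0, hy.2⟩ h0.symm ?_
  rcases hy.2.eq_or_lt with hyR | hyR
  · subst hyR
    have hPR := h.pos (s := y) ⟨hy0, le_rfl⟩
    -- At a zero of `φ` at `R`, the difference quotients from the left are nonpositive, while the
    -- Robin inequality reduces to `0 ≤ P R * ψ R`.
    refine le_antisymm ?_ ?_
    · have hw := (hφ.hasDerivAt y).hasDerivWithinAt (s := Iio y)
      rw [hasDerivWithinAt_iff_tendsto_slope' (by simp)] at hw
      refine le_of_tendsto hw ?_
      filter_upwards [Ioo_mem_nhdsLT hy0] with z hz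
      rw [slope_def_field, ← h0, sub_zero]
      exact div_nonpos_of_nonneg_of_nonpos (hnn z (Ioo_subset_Icc_self hz)) (by linarith [hz.2])
    · rw [← h0, mul_zero, add_zero] at hrob
      exact nonneg_of_mul_nonneg_right hrob hPR
  · have hmin : IsLocalMin φ y := by
      filter_upwards [Ioo_mem_nhds hy0 hyR] with z hz
      rw [← h0]
      exact hnn z (Ioo_subset_Icc_self hz)
    exact hmin.hasDerivAt_eq_zero (hφ.hasDerivAt y)

/-- As long as `φ` is positive its flux `∫ e φ` is nonnegative, so `φ` increases from the value `1`
and cannot reach a first zero. -/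
theorem IsRegularSolution.pos_of_coeff_nonneg (hR : 0 < R) (h : IsSingularPair k R P e)
    (hφ : IsRegularSolution R P e φ ψ) (he : ∀ y ∈ Icc 0 R, 0 ≤ e y) :
    (∀ y ∈ Icc 0 R, 0 < φ y) ∧ 0 ≤ P R * ψ R := by
  have hfl : ∀ b ∈ Icc 0 R, (∀ y ∈ Ioo 0 b, 0 < φ y) → 0 ≤ P b * ψ b := by
    intro b hb hp
    rw [hφ.flux b hb, intervalIntegral.integral_of_le hb.1, integral_Ioc_eq_integral_Ioo]
    refine setIntegral_nonneg measurableSet_Ioo fun t ht => ?_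
    exact mul_nonneg (he t ⟨ht.1.le, ht.2.le.trans hb.2⟩) (hp t ht).le
  have hpos : ∀ y ∈ Icc 0 R, 0 < φ y := by
    by_contra! hcon
    obtain ⟨y, hy, hy0⟩ := hcon
    have hK : IsCompact (Icc 0 R ∩ φ ⁻¹' Iic 0) :=
      isCompact_Icc.inter_right (isClosed_Iic.preimage hφ.continuous)
    obtain ⟨b, hb, hbl⟩ := hK.exists_isLeast ⟨y, hy, hy0⟩
    have hlt : ∀ z ∈ Ioo 0 b, 0 < φ z := by
      intro z hz
      by_contra hn
      have := hbl ⟨⟨hz.1.le, hz.2.le.trans hb.1.2⟩, not_lt.1 hn⟩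
      linarith [hz.2]
    have hmono : MonotoneOn φ (Icc 0 b) := by
      refine monotoneOn_of_deriv_nonneg (convex_Icc 0 b) hφ.continuous.continuousOn
        (fun z _ => (hφ.hasDerivAt z).differentiableAt.differentiableWithinAt) fun z hz => ?_
      rw [interior_Icc] at hz
      rw [(hφ.hasDerivAt z).deriv]
      have hzR : z ∈ Ioc 0 R := ⟨hz.1, hz.2.le.trans hb.1.2⟩
      exact nonneg_of_mul_nonneg_right (hfl z (Ioc_subset_Icc_self hzR) fun t ht =>
        hlt t ⟨ht.1, ht.2.trans hz.2⟩) (h.pos hzR)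
    have h1 := hmono ⟨le_rfl, hb.1.1⟩ ⟨hb.1.1, le_rfl⟩ hb.1.1
    rw [hφ.apply_zero] at h1
    have h2 : φ b ≤ 0 := hb.2
    linarith
  exact ⟨hpos, hfl R ⟨hR.le, le_rfl⟩ fun y hy => hpos y (Ioo_subset_Icc_self hy)⟩

theorem isRadialProfile_one (k : ℕ) (R : ℝ) : IsRadialProfile k R fun _ => 1 := by
  refine ⟨fun a _ => contDiff_const.contDiffOn.absolutelyContinuousOnInterval, ?_, ?_⟩
  · exact (by fun_prop : Continuous fun y : ℝ => y ^ k * (1 : ℝ) ^ 2).integrableOn_Ioc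
  · simp

theorem IsSingularPair.sub_mul {w : ℝ → ℝ} (h : IsSingularPair k R P e)
    (hw : IsSingularPair k R P w) (μ : ℝ) : IsSingularPair k R P fun t => e t - μ * w t := by
  obtain ⟨C, hC, he⟩ := h.upper
  obtain ⟨D, hD, hw'⟩ := hw.upper
  refine ⟨h.continuous_left, h.continuous_right.sub (continuous_const.mul hw.continuous_right),
    h.lower, C + |μ| * D, by positivity, fun s hs => ?_⟩
  refine (abs_sub _ _).trans ?_
  rw [abs_mul, add_mul, mul_assoc]
  exact add_le_add (he s hs) (mul_le_mul_of_nonneg_left (hw' s hs) (abs_nonneg μ))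

/-- Existence of a positive solution of `(P φ')' = (e - μ w) φ`, regular at `0`, with the
Robin condition at `R`. -/
theorem exists_ground_state (hR : 0 < R) {w : ℝ → ℝ} (h : IsSingularPair k R P e)
    (hw : IsSingularPair k R P w) {C : ℝ} (hPu : ∀ s ∈ Icc 0 R, |P s| ≤ C * s ^ k)
    (hwl : ∃ c, 0 < c ∧ ∀ s ∈ Icc 0 R, c * s ^ k ≤ w s) {β : ℝ} (hβ : 0 ≤ β) :
    ∃ (μ : ℝ) (φ ψ : ℝ → ℝ), IsRegularSolution R P (fun t => e t - μ * w t) φ ψ ∧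
      (∀ y ∈ Icc 0 R, 0 < φ y) ∧ P R * ψ R + β * φ R = 0 := by
  obtain ⟨φ, ψ, hφ, hc, hcR⟩ := exists_isRegularSolution_family hR h hw (h.sub_mul hw)
  have hRR : R ∈ Icc 0 R := ⟨hR.le, le_rfl⟩
  set F : ℝ → ℝ := fun μ => P R * ψ μ R + β * φ μ R with hF
  have hcy : ∀ y ∈ Icc 0 R, Continuous fun μ => φ μ y := fun y hy =>
    continuous_iff_continuousAt.2 fun μ₀ => Metric.tendsto_nhds.2 fun ε hε =>
      (hc μ₀ ε hε).mono fun μ hμ => hμ y hy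
  have hFc : Continuous F := hcR.add (continuous_const.mul (hcy R hRR))
  set S : Set ℝ := {μ | (∀ y ∈ Icc 0 R, 0 < φ μ y) ∧ 0 ≤ F μ} with hS
  have hne : S.Nonempty := by
    obtain ⟨C', hC', he⟩ := h.upper
    obtain ⟨c, hcp, hw'⟩ := hwl
    -- For this `μ` the coefficient `e - μ w` is nonnegative, because `|e| ≤ C' y^k` and `w ≥ c
    -- y^k`.
    obtain ⟨h1, h2⟩ := (hφ (-(C' / c))).pos_of_coeff_nonneg hR (h.sub_mul hw _) fun y hy => by
      have h3 := (abs_le.1 (he y hy)).1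
      have h4 : C' / c * (c * y ^ k) ≤ C' / c * w y :=
        mul_le_mul_of_nonneg_left (hw' y hy) (by positivity)
      have h5 : C' / c * (c * y ^ k) = C' * y ^ k := by field_simp
      linarith
    exact ⟨_, h1, add_nonneg h2 (mul_nonneg hβ (h1 R hRR).le)⟩
  have hwint : 0 < ∫ y in (0 : ℝ)..R, w y := by
    obtain ⟨c, hcp, hw'⟩ := hwl
    refine intervalIntegral.intervalIntegral_pos_of_pos_on
      (hw.continuous_right.intervalIntegrable _ _) (fun y hy => ?_) hR
    exact (mul_pos hcp (pow_pos hy.1 k)).trans_le (hw' y (Ioo_subset_Icc_self hy))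
  -- Picone's inequality tested with the constant `1` bounds every `μ` in `S` by the Rayleigh
  -- quotient of `1`.
  have hbdd : BddAbove S := by
    refine ⟨((∫ y in (0 : ℝ)..R, e y) + β) / ∫ y in (0 : ℝ)..R, w y, fun μ hμ => ?_⟩
    have h1 := (hφ μ).picone hR (h.sub_mul hw μ) hPu hμ.1 (isRadialProfile_one k R)
    have h2 : ∫ y in (0 : ℝ)..R, (P y * deriv (fun _ : ℝ => (1 : ℝ)) y ^ 2
        + (e y - μ * w y) * (1 : ℝ) ^ 2)
        = (∫ y in (0 : ℝ)..R, e y) - μ * ∫ y in (0 : ℝ)..R, w y := by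
      rw [← intervalIntegral.integral_const_mul, ← intervalIntegral.integral_sub
        (h.continuous_right.intervalIntegrable _ _)
        ((hw.continuous_right.intervalIntegrable _ _).const_mul μ)]
      simp
    rw [h2] at h1
    have h3 := hμ.1 R hRR
    have h4 : -β ≤ P R * ψ μ R / φ μ R := by
      rw [le_div_iff₀ h3]
      have : 0 ≤ P R * ψ μ R + β * φ μ R := hμ.2
      linarith
    rw [le_div_iff₀ hwint]
    simp only [one_pow, one_mul] at h1
    linarith
  set μ₀ := sSup S with hμ₀
  have hfreq : ∃ᶠ μ in 𝓝 μ₀, μ ∈ S := mem_closure_iff_frequently.1 (csSup_mem_closure hne hbdd)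
  have hnn : ∀ y ∈ Icc 0 R, 0 ≤ φ μ₀ y := by
    intro y hy
    by_contra hn
    have hev := (hcy y hy).continuousAt.eventually (gt_mem_nhds (not_le.1 hn))
    obtain ⟨μ, h1, h2⟩ := (hfreq.and_eventually hev).exists
    exact lt_asymm (h1.1 y hy) h2
  have hF0 : 0 ≤ F μ₀ := by
    by_contra hn
    have hev := hFc.continuousAt.eventually (gt_mem_nhds (not_le.1 hn))
    obtain ⟨μ, h1, h2⟩ := (hfreq.and_eventually hev).exists
    exact absurd h1.2 (not_le.2 h2)
  have hpos := (hφ μ₀).pos_of_nonneg hR (h.sub_mul hw μ₀) hnn hF0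
  refine ⟨μ₀, φ μ₀, ψ μ₀, hφ μ₀, hpos, ?_⟩
  by_contra hne0
  have hFp : 0 < F μ₀ := lt_of_le_of_ne hF0 (Ne.symm hne0)
  obtain ⟨y₀, hy₀, hmin⟩ := (isCompact_Icc (a := (0 : ℝ)) (b := R)).exists_isMinOn
    ⟨0, le_rfl, hR.le⟩ (hφ μ₀).continuous.continuousOn
  -- Uniform closeness within the minimum of `φ μ₀` keeps `φ μ` positive on the whole interval, so
  -- `S` would contain points above its supremum.
  have hev : ∀ᶠ μ in 𝓝 μ₀, μ ∈ S := by
    filter_upwards [hc μ₀ _ (hpos y₀ hy₀), hFc.continuousAt.eventually (lt_mem_nhds hFp)]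
      with μ h1 h2
    refine ⟨fun y hy => ?_, le_of_lt h2⟩
    have h3 := (abs_lt.1 (h1 y hy)).1
    have h4 : φ μ₀ y₀ ≤ φ μ₀ y := hmin hy
    linarith
  obtain ⟨μ, h1, h2⟩ := ((hev.filter_mono nhdsWithin_le_nhds).and
    (self_mem_nhdsWithin : Ioi μ₀ ∈ 𝓝[>] μ₀)).exists
  exact absurd (le_csSup hbdd h1) (not_le.2 h2)

theorem contDiffOn_succ_of_hasDerivWithinAt {s : Set ℝ} (hs : UniqueDiffOn ℝ s) {f g : ℝ → ℝ}
    {n : ℕ} (hf : ∀ y ∈ s, HasDerivWithinAt f (g y) s y) (hg : ContDiffOn ℝ n g s) :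
    ContDiffOn ℝ (n + 1) f s := by
  rw [contDiffOn_succ_iff_derivWithin hs]
  refine ⟨fun y hy => (hf y hy).differentiableWithinAt, by simp, hg.congr fun y hy => ?_⟩
  exact (hf y hy).derivWithin (hs y hy)

end GroundState
-- The star: coefficients, quadratic form, eigenfunctions and growing modes.
section Star

variable {d : ℕ} {γ R : ℝ} {ρ : ℝ → ℝ}

/-- The extension of the density by constants. -/
def clampDensity (R : ℝ) (ρ : ℝ → ℝ) (y : ℝ) : ℝ := ρ (max 0 (min y R))

/-- The mass inside the ball of radius `y`, up to a constant. -/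
noncomputable def mass (d : ℕ) (R : ℝ) (ρ : ℝ → ℝ) (y : ℝ) : ℝ :=
  ∫ s in (0 : ℝ)..y, s ^ (d - 1) * clampDensity R ρ s

/-- The gradient of the pressure, from the momentum equation. -/
noncomputable def pressureGrad (d : ℕ) (R : ℝ) (ρ : ℝ → ℝ) (y : ℝ) : ℝ :=
  -(4 * Real.pi / y ^ (d - 1) * mass d R ρ y) * clampDensity R ρ y

/-- The leading coefficient of the operator `L`. -/
noncomputable def coeffP (d : ℕ) (γ R : ℝ) (ρ : ℝ → ℝ) (y : ℝ) : ℝ :=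
  γ * clampDensity R ρ y ^ γ * y ^ (d + 1)

/-- The potential of the operator `L`. -/
noncomputable def coeffE (d : ℕ) (γ R : ℝ) (ρ : ℝ → ℝ) (y : ℝ) : ℝ :=
  (2 * ((d : ℝ) - 1) - d * γ) * (-(4 * Real.pi) * (clampDensity R ρ y * (y * mass d R ρ y)))

/-- The weight of the eigenvalue problem. -/
noncomputable def coeffW (d : ℕ) (R : ℝ) (ρ : ℝ → ℝ) (y : ℝ) : ℝ :=
  y ^ (d + 1) * clampDensity R ρ y

theorem clampDensity_of_mem {y : ℝ} (hy : y ∈ Icc 0 R) : clampDensity R ρ y = ρ y := by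
  simp [clampDensity, hy.1, hy.2]

namespace IsLiquidStar

theorem continuous_clampDensity (hρ : IsLiquidStar d γ R ρ) : Continuous (clampDensity R ρ) := by
  refine hρ.continuousOn.comp_continuous (by fun_prop) fun y => ⟨le_max_left _ _, ?_⟩
  exact max_le hρ.radius_pos.le (min_le_right _ _)

theorem clampDensity_pos (hρ : IsLiquidStar d γ R ρ) (y : ℝ) : 0 < clampDensity R ρ y :=
  hρ.pos _ ⟨le_max_left _ _, max_le hρ.radius_pos.le (min_le_right _ _)⟩

theorem exists_bounds (hρ : IsLiquidStar d γ R ρ) :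
    ∃ a A : ℝ, 0 < a ∧ 0 < A ∧ ∀ y, a ≤ clampDensity R ρ y ∧ clampDensity R ρ y ≤ A := by
  have hne : (Icc 0 R).Nonempty := ⟨0, le_rfl, hρ.radius_pos.le⟩
  obtain ⟨u, hu, hmin⟩ := isCompact_Icc.exists_isMinOn hne hρ.continuousOn
  obtain ⟨v, hv, hmax⟩ := isCompact_Icc.exists_isMaxOn hne hρ.continuousOn
  refine ⟨ρ u, ρ v, hρ.pos u hu, hρ.pos v hv, fun y => ?_⟩
  have hy : max 0 (min y R) ∈ Icc 0 R :=
    ⟨le_max_left _ _, max_le hρ.radius_pos.le (min_le_right _ _)⟩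
  exact ⟨hmin hy, hmax hy⟩

theorem continuous_mass_integrand (hρ : IsLiquidStar d γ R ρ) :
    Continuous fun s => s ^ (d - 1) * clampDensity R ρ s :=
  (continuous_id.pow _).mul hρ.continuous_clampDensity

theorem continuous_mass (hρ : IsLiquidStar d γ R ρ) : Continuous (mass d R ρ) :=
  intervalIntegral.continuous_primitive
    (fun a b => hρ.continuous_mass_integrand.intervalIntegrable a b) 0

theorem abs_mass_le (hd : 1 ≤ d) {A : ℝ} (hρ : IsLiquidStar d γ R ρ)
    (hA : ∀ y, clampDensity R ρ y ≤ A) {y : ℝ} (hy : 0 ≤ y) : |mass d R ρ y| ≤ A * y ^ d := by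
  have h1 : ∀ t ∈ uIoc 0 y, ‖t ^ (d - 1) * clampDensity R ρ t‖ ≤ y ^ (d - 1) * A := by
    intro t ht
    rw [uIoc_of_le hy] at ht
    have h2 := hρ.clampDensity_pos t
    rw [Real.norm_eq_abs, abs_of_nonneg (mul_nonneg (pow_nonneg ht.1.le _) h2.le)]
    exact mul_le_mul (pow_le_pow_left₀ ht.1.le ht.2 _) (hA t) h2.le (pow_nonneg hy _)
  have h2 := intervalIntegral.norm_integral_le_of_norm_le_const h1
  rw [sub_zero, abs_of_nonneg hy] at h2
  refine h2.trans (le_of_eq ?_)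
  obtain ⟨j, rfl⟩ : ∃ j, d = j + 1 := ⟨d - 1, by omega⟩
  simp only [Nat.add_sub_cancel]
  ring

theorem hasDerivAt_pressure (hρ : IsLiquidStar d γ R ρ) {y : ℝ} (hy : y ∈ Ioo 0 R) :
    HasDerivAt (fun s => ρ s ^ γ) (pressureGrad d R ρ y) y := by
  have hyI := Ioo_subset_Icc_self hy
  have h1 := hρ.momentum y hy
  have hm : ∫ s in (0 : ℝ)..y, s ^ (d - 1) * ρ s = mass d R ρ y := by
    refine intervalIntegral.integral_congr fun s hs => ?_
    rw [uIcc_of_le hy.1.le] at hs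
    rw [clampDensity_of_mem ⟨hs.1, hs.2.trans hy.2.le⟩]
  rw [hm] at h1
  have h2 : deriv (fun s => ρ s ^ γ) y = pressureGrad d R ρ y := by
    have hne := (hρ.pos y hyI).ne'
    rw [pressureGrad, clampDensity_of_mem hyI, ← eq_neg_of_add_eq_zero_left h1]
    field_simp
  rw [← h2]
  exact (hρ.differentiableAt y hy).hasDerivAt

/-- The factor `y^d` absorbs the singular `y^(1-d)` of the momentum equation. This is why `coeffE`
is written through the mass and is continuous across `0`. -/
theorem pow_mul_pressureGrad (hd : 1 ≤ d) {y : ℝ} (hy : 0 < y) :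
    y ^ d * pressureGrad d R ρ y
      = -(4 * Real.pi) * (clampDensity R ρ y * (y * mass d R ρ y)) := by
  obtain ⟨j, rfl⟩ : ∃ j, d = j + 1 := ⟨d - 1, by omega⟩
  simp only [pressureGrad, Nat.add_sub_cancel]
  have : y ^ j ≠ 0 := (pow_pos hy j).ne'
  field_simp
  ring

theorem continuousOn_pressureGrad (hρ : IsLiquidStar d γ R ρ) :
    ContinuousOn (pressureGrad d R ρ) (Ioc 0 R) := by
  have h1 := hρ.continuous_mass
  have h2 := hρ.continuous_clampDensity
  have h3 : ContinuousOn (fun y : ℝ => 4 * Real.pi / y ^ (d - 1)) (Ioc 0 R) :=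
    continuousOn_const.div (by fun_prop) fun y hy => (pow_pos hy.1 _).ne'
  exact ((h3.mul h1.continuousOn).neg).mul h2.continuousOn

/-- The momentum equation holds only inside, but its right side has a limit at `R`, and this gives
the one-sided derivative there. It is needed for `C²` regularity of eigenfunctions up to the
boundary. -/
theorem hasDerivWithinAt_pressure (hρ : IsLiquidStar d γ R ρ) {y : ℝ} (hy : y ∈ Ioc 0 R) :
    HasDerivWithinAt (fun s => clampDensity R ρ s ^ γ) (pressureGrad d R ρ y) (Ioc 0 R) y := by
  have heq : ∀ z ∈ Ioc 0 R, clampDensity R ρ z ^ γ = ρ z ^ γ := fun z hz => by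
    rw [clampDensity_of_mem (Ioc_subset_Icc_self hz)]
  have hIoo : ∀ z ∈ Ioo 0 R, HasDerivAt (fun s => clampDensity R ρ s ^ γ)
      (pressureGrad d R ρ z) z := fun z hz => by
    refine (hρ.hasDerivAt_pressure hz).congr_of_eventuallyEq ?_
    filter_upwards [isOpen_Ioo.mem_nhds hz] with x hx
    exact heq x (Ioo_subset_Ioc_self hx)
  rcases hy.2.eq_or_lt with h | h
  · subst h
    have h1 : HasDerivWithinAt (fun s => clampDensity y ρ s ^ γ) (pressureGrad d y ρ y)
        (Iic y) y := by
      refine hasDerivWithinAt_Iic_of_tendsto_deriv (s := Ioo 0 y)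
        (fun z hz => (hIoo z hz).differentiableAt.differentiableWithinAt) ?_
        (Ioo_mem_nhdsLT hy.1) ?_
      · exact (hρ.continuous_clampDensity.continuousAt.rpow_const
          (Or.inl (hρ.clampDensity_pos y).ne')).continuousWithinAt
      · have h2 := (hρ.continuousOn_pressureGrad y hy).mono_left
          (nhdsWithin_mono y Ioo_subset_Ioc_self)
        rw [nhdsWithin_Ioo_eq_nhdsLT hy.1] at h2
        refine h2.congr' ?_
        filter_upwards [Ioo_mem_nhdsLT hy.1] with z hz
        exact (hIoo z hz).deriv.symm
    exact h1.mono fun z hz => hz.2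
  · exact (hIoo y ⟨hy.1, h⟩).hasDerivWithinAt

theorem abs_coeffP_le (hγ : 1 ≤ γ) (hρ : IsLiquidStar d γ R ρ) :
    ∃ C, ∀ s ∈ Icc 0 R, |coeffP d γ R ρ s| ≤ C * s ^ (d + 1) := by
  obtain ⟨a, A, ha, hA, hb⟩ := hρ.exists_bounds
  have hγ0 : 0 < γ := by linarith
  refine ⟨γ * A ^ γ, fun s hs => ?_⟩
  have h1 : clampDensity R ρ s ^ γ ≤ A ^ γ :=
    Real.rpow_le_rpow (hρ.clampDensity_pos s).le (hb s).2 hγ0.le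
  have h2 := Real.rpow_pos_of_pos (hρ.clampDensity_pos s) γ
  have h3 := pow_nonneg hs.1 (d + 1)
  rw [coeffP, abs_of_nonneg (by positivity)]
  gcongr

theorem continuous_coeffP (hρ : IsLiquidStar d γ R ρ) : Continuous (coeffP d γ R ρ) :=
  (continuous_const.mul (hρ.continuous_clampDensity.rpow_const
    fun y => Or.inl (hρ.clampDensity_pos y).ne')).mul (continuous_id.pow _)

theorem lower_coeffP (hγ : 1 ≤ γ) (hρ : IsLiquidStar d γ R ρ) :
    ∃ c, 0 < c ∧ ∀ s ∈ Icc 0 R, c * s ^ (d + 1) ≤ coeffP d γ R ρ s := by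
  obtain ⟨a, A, ha, hA, hb⟩ := hρ.exists_bounds
  have hγ0 : 0 < γ := by linarith
  have hag := Real.rpow_pos_of_pos ha γ
  refine ⟨γ * a ^ γ, mul_pos hγ0 hag, fun s hs => ?_⟩
  have h1 : a ^ γ ≤ clampDensity R ρ s ^ γ := Real.rpow_le_rpow ha.le (hb s).1 hγ0.le
  have h3 := pow_nonneg hs.1 (d + 1)
  rw [coeffP]
  gcongr

/-- The mass is `O(y^d)`, so the potential is `O(y^(d+1))`, the order of the leading coefficient. -/
theorem isSingularPair_coeffE (hd : 1 ≤ d) (hγ : 1 ≤ γ) (hρ : IsLiquidStar d γ R ρ) :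
    IsSingularPair (d + 1) R (coeffP d γ R ρ) (coeffE d γ R ρ) := by
  obtain ⟨a, A, ha, hA, hb⟩ := hρ.exists_bounds
  have h1 := hρ.continuous_mass
  have h2 := hρ.continuous_clampDensity
  refine ⟨hρ.continuous_coeffP, by unfold coeffE; fun_prop, hρ.lower_coeffP hγ,
    |2 * ((d : ℝ) - 1) - d * γ| * (4 * Real.pi * (A * A)),
    mul_nonneg (abs_nonneg _) (by positivity), fun s hs => ?_⟩
  have h3 := hρ.abs_mass_le hd (fun y => (hb y).2) hs.1
  have hpi : |4 * Real.pi| = 4 * Real.pi := abs_of_pos (by positivity)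
  have hcl : |clampDensity R ρ s| = clampDensity R ρ s := abs_of_pos (hρ.clampDensity_pos s)
  rw [coeffE, abs_mul, abs_mul, abs_mul, abs_mul, abs_neg, hpi, hcl, abs_of_nonneg hs.1]
  have h4 : clampDensity R ρ s * (s * |mass d R ρ s|) ≤ A * (s * (A * s ^ d)) :=
    mul_le_mul (hb s).2 (mul_le_mul_of_nonneg_left h3 hs.1)
      (mul_nonneg hs.1 (abs_nonneg _)) hA.le
  have h5 : 0 ≤ |2 * ((d : ℝ) - 1) - d * γ| * (4 * Real.pi) :=
    mul_nonneg (abs_nonneg _) (by positivity)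
  calc _ = |2 * ((d : ℝ) - 1) - d * γ| * (4 * Real.pi)
        * (clampDensity R ρ s * (s * |mass d R ρ s|)) := by ring
    _ ≤ |2 * ((d : ℝ) - 1) - d * γ| * (4 * Real.pi) * (A * (s * (A * s ^ d))) :=
        mul_le_mul_of_nonneg_left h4 h5
    _ = _ := by ring

theorem isSingularPair_coeffW (hγ : 1 ≤ γ) (hρ : IsLiquidStar d γ R ρ) :
    IsSingularPair (d + 1) R (coeffP d γ R ρ) (coeffW d R ρ) := by
  obtain ⟨a, A, ha, hA, hb⟩ := hρ.exists_bounds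
  refine ⟨hρ.continuous_coeffP, (continuous_id.pow _).mul hρ.continuous_clampDensity,
    hρ.lower_coeffP hγ, A, hA.le, fun s hs => ?_⟩
  have h3 := pow_nonneg hs.1 (d + 1)
  rw [coeffW, abs_of_nonneg (mul_nonneg h3 (hρ.clampDensity_pos s).le), mul_comm]
  exact mul_le_mul_of_nonneg_right (hb s).2 h3

theorem lower_coeffW (hρ : IsLiquidStar d γ R ρ) :
    ∃ c, 0 < c ∧ ∀ s ∈ Icc 0 R, c * s ^ (d + 1) ≤ coeffW d R ρ s := by
  obtain ⟨a, A, ha, hA, hb⟩ := hρ.exists_bounds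
  refine ⟨a, ha, fun s hs => ?_⟩
  rw [coeffW, mul_comm]
  exact mul_le_mul_of_nonneg_left (hb s).1 (pow_nonneg hs.1 (d + 1))

theorem contDiffOn_coeffP (hρ : IsLiquidStar d γ R ρ) :
    ContDiffOn ℝ 1 (coeffP d γ R ρ) (Ioc 0 R) := by
  have h1 : ContDiffOn ℝ 1 (fun s => clampDensity R ρ s ^ γ) (Ioc 0 R) := by
    have := contDiffOn_succ_of_hasDerivWithinAt (n := 0) (uniqueDiffOn_Ioc 0 R)
      (fun y hy => hρ.hasDerivWithinAt_pressure hy)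
      (contDiffOn_zero.2 hρ.continuousOn_pressureGrad)
    simpa using this
  exact (contDiffOn_const.mul h1).mul (contDiff_id.pow (d + 1)).contDiffOn

theorem coeffP_radius (hρ : IsLiquidStar d γ R ρ) : coeffP d γ R ρ R = γ * R ^ (d + 1) := by
  rw [coeffP, clampDensity_of_mem ⟨hρ.radius_pos.le, le_rfl⟩, hρ.boundary, Real.one_rpow, mul_one]

end IsLiquidStar

/-- The square of the weighted norm. -/
noncomputable def wNormSq (d : ℕ) (R : ℝ) (ρ χ : ℝ → ℝ) : ℝ :=
  ∫ y in (0 : ℝ)..R, coeffW d R ρ y * χ y ^ 2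

variable {χ : ℝ → ℝ} {ν : ℝ}

theorem wNorm_eq_sqrt (hR : 0 ≤ R) : wNorm d R ρ χ = Real.sqrt (wNormSq d R ρ χ) := by
  rw [wNorm, wNormSq]
  congr 1
  refine intervalIntegral.integral_congr fun y hy => ?_
  rw [uIcc_of_le hR] at hy
  simp only [coeffW, clampDensity_of_mem hy]
  ring

theorem IsLiquidStar.wNormSq_nonneg (hρ : IsLiquidStar d γ R ρ) : 0 ≤ wNormSq d R ρ χ := by
  refine intervalIntegral.integral_nonneg hρ.radius_pos.le fun y hy => ?_
  have := pow_nonneg hy.1 (d + 1)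
  have := hρ.clampDensity_pos y
  rw [coeffW]
  positivity

theorem IsLiquidStar.wNormSq_pos (hγ : 1 ≤ γ) (hρ : IsLiquidStar d γ R ρ)
    (hχ : IsRadialProfile (d + 1) R χ) (hne : ∃ y ∈ Ioc 0 R, χ y ≠ 0) : 0 < wNormSq d R ρ χ := by
  refine lt_of_le_of_ne hρ.wNormSq_nonneg fun h0 => ?_
  have hR := hρ.radius_pos
  obtain ⟨C, -, hC⟩ := (hρ.isSingularPair_coeffW hγ).upper
  have hint := hχ.integrableOn_weight (hρ.isSingularPair_coeffW hγ).continuous_right hC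
  rw [wNormSq, intervalIntegral.integral_of_le hR.le, eq_comm,
    setIntegral_eq_zero_iff_of_nonneg_ae ?_ hint] at h0
  · have heq : EqOn χ (fun _ => 0) (Ioc 0 R) := by
      refine Measure.eqOn_Ioc_of_ae_eq volume ?_ hχ.continuousOn continuousOn_const
      filter_upwards [h0, ae_restrict_mem measurableSet_Ioc] with y hy hyI
      have hw : 0 < coeffW d R ρ y := mul_pos (pow_pos hyI.1 _) (hρ.clampDensity_pos y)
      rcases mul_eq_zero.1 hy with h | h
      · exact absurd h hw.ne'
      · exact pow_eq_zero_iff two_ne_zero |>.1 h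
    obtain ⟨y, hy, hy0⟩ := hne
    exact hy0 (heq hy)
  · filter_upwards [ae_restrict_mem measurableSet_Ioc] with y hyI
    have hw : 0 < coeffW d R ρ y := mul_pos (pow_pos hyI.1 _) (hρ.clampDensity_pos y)
    simp only [Pi.zero_apply]
    positivity

theorem IsLiquidStar.Q_sub_mul_wNormSq (hd : 1 ≤ d) (hγ : 1 ≤ γ) (hρ : IsLiquidStar d γ R ρ)
    (hχ : IsRadialProfile (d + 1) R χ) (ν : ℝ) :
    Q d γ R ρ χ χ - ν * wNormSq d R ρ χ
      = (∫ y in (0 : ℝ)..R, (coeffP d γ R ρ y * deriv χ y ^ 2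
          + (coeffE d γ R ρ y - ν * coeffW d R ρ y) * χ y ^ 2)) + d * γ * R ^ d * χ R ^ 2 := by
  have hR := hρ.radius_pos
  have hE := hρ.isSingularPair_coeffE hd hγ
  have hW := hρ.isSingularPair_coeffW hγ
  obtain ⟨C, hC⟩ := hρ.abs_coeffP_le hγ
  obtain ⟨D, -, hD⟩ := hW.upper
  have i1 := (intervalIntegrable_iff_integrableOn_Ioc_of_le hR.le).2 (hχ.integrableOn_energy hE hC)
  have i2 := (intervalIntegrable_iff_integrableOn_Ioc_of_le hR.le).2
    (hχ.integrableOn_weight hW.continuous_right hD)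
  have h1 : ∫ y in (0 : ℝ)..R, (coeffP d γ R ρ y * deriv χ y ^ 2
      + (coeffE d γ R ρ y - ν * coeffW d R ρ y) * χ y ^ 2)
      = (∫ y in (0 : ℝ)..R, (coeffP d γ R ρ y * deriv χ y ^ 2 + coeffE d γ R ρ y * χ y ^ 2))
        - ν * wNormSq d R ρ χ := by
    rw [wNormSq, ← intervalIntegral.integral_const_mul,
      ← intervalIntegral.integral_sub i1 (i2.const_mul ν)]
    refine intervalIntegral.integral_congr fun y _ => ?_
    ring
  have h2 : (∫ y in (0 : ℝ)..R,
      (γ * ρ y ^ γ * y ^ (d + 1) * deriv χ y * deriv χ y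
        + (2 * ((d : ℝ) - 1) - d * γ) * y ^ d * χ y * χ y * deriv (fun s => ρ s ^ γ) y))
      = ∫ y in (0 : ℝ)..R, (coeffP d γ R ρ y * deriv χ y ^ 2 + coeffE d γ R ρ y * χ y ^ 2) := by
    -- The endpoint is discarded: the two-sided `deriv` of `ρ^γ` at `R` carries no information.
    rw [intervalIntegral.integral_of_le hR.le, intervalIntegral.integral_of_le hR.le,
      integral_Ioc_eq_integral_Ioo, integral_Ioc_eq_integral_Ioo]
    refine setIntegral_congr_fun measurableSet_Ioo fun y hy => ?_
    have hyI := Ioo_subset_Icc_self hy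
    simp only [coeffP, coeffE]
    rw [← IsLiquidStar.pow_mul_pressureGrad hd hy.1, (hρ.hasDerivAt_pressure hy).deriv,
      clampDensity_of_mem hyI]
    ring
  rw [h1, Q, h2]
  ring

theorem IsEigenfunction.hasDerivAt_flux (hd : 1 ≤ d) (hρ : IsLiquidStar d γ R ρ)
    (hχ : IsEigenfunction d γ R ρ ν χ) {y : ℝ} (hy : y ∈ Ioo 0 R) :
    HasDerivAt (fun s => coeffP d γ R ρ s * deriv χ s)
      ((coeffE d γ R ρ y - ν * coeffW d R ρ y) * χ y) y := by
  have hyI := Ioo_subset_Icc_self hy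
  have hcd : ContDiffOn ℝ 1 (deriv χ) (Ioo 0 R) :=
    ((contDiffOn_succ_iff_deriv_of_isOpen isOpen_Ioo (n := 1)).1
      (hχ.contDiffOn.mono Ioo_subset_Ioc_self)).2.2
  have hdd : DifferentiableAt ℝ (deriv χ) y :=
    (hcd.contDiffAt (isOpen_Ioo.mem_nhds hy)).differentiableAt one_ne_zero
  have hf : DifferentiableAt ℝ (fun s => ρ s ^ γ * s ^ (d + 1) * deriv χ s) y :=
    ((hρ.differentiableAt y hy).mul (differentiableAt_pow _)).mul hdd
  have heqn := hχ.eqn y hy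
  rw [L, (hρ.hasDerivAt_pressure hy).deriv] at heqn
  have h1 : HasDerivAt (fun s => γ * (ρ s ^ γ * s ^ (d + 1) * deriv χ s)) _ y :=
    hf.hasDerivAt.const_mul γ
  refine (h1.congr_of_eventuallyEq ?_).congr_deriv ?_
  · filter_upwards [isOpen_Ioo.mem_nhds hy] with s hs
    rw [coeffP, clampDensity_of_mem (Ioo_subset_Icc_self hs)]
    ring
  · rw [coeffE, coeffW, ← IsLiquidStar.pow_mul_pressureGrad hd hy.1, clampDensity_of_mem hyI]
    linear_combination -heqn

/-- The energy identity reduces the integral to the boundary term at `R`, which the Robin condition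
cancels against the boundary term of `Q`. -/
theorem IsEigenfunction.Q_eq (hd : 1 ≤ d) (hγ : 1 ≤ γ) (hρ : IsLiquidStar d γ R ρ)
    (hχ : IsEigenfunction d γ R ρ ν χ) : Q d γ R ρ χ χ = ν * wNormSq d R ρ χ := by
  have hR := hρ.radius_pos
  have hprof : IsRadialProfile (d + 1) R χ := hχ.memH1r.isRadialProfile hR
  obtain ⟨C, hC⟩ := hρ.abs_coeffP_le hγ
  have hpair := (hρ.isSingularPair_coeffE hd hγ).sub_mul (hρ.isSingularPair_coeffW hγ) ν
  set θ : ℝ → ℝ := derivWithin χ (Ioc 0 R) with hθdef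
  have hcd : ContDiffOn ℝ 1 θ (Ioc 0 R) :=
    ((contDiffOn_succ_iff_derivWithin (uniqueDiffOn_Ioc 0 R) (n := 1)).1 hχ.contDiffOn).2.2
  have hθeq : ∀ y ∈ Ioo 0 R, θ y = deriv χ y := fun y hy =>
    derivWithin_of_mem_nhds (Ioc_mem_nhds hy.1 hy.2)
  have hθ : ∀ y ∈ Ioo 0 R, HasDerivAt χ (θ y) y := fun y hy => by
    rw [hθeq y hy]
    exact ((hχ.contDiffOn.contDiffAt (Ioc_mem_nhds hy.1 hy.2)).differentiableAt
      two_ne_zero).hasDerivAt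
  have hid := hprof.energy_identity hd hR hpair hC hcd.continuousOn hθ fun y hy => by
    refine (hχ.hasDerivAt_flux hd hρ hy).congr_of_eventuallyEq ?_
    filter_upwards [isOpen_Ioo.mem_nhds hy] with s hs
    rw [hθeq s hs]
  have h1 := hρ.Q_sub_mul_wNormSq hd hγ hprof ν
  have hrob : d * χ R + R * θ R = 0 := hχ.robin
  rw [hid, hρ.coeffP_radius] at h1
  have h2 : γ * R ^ (d + 1) * θ R * χ R + d * γ * R ^ d * χ R ^ 2 = 0 := by
    linear_combination (γ * R ^ d * χ R) * hrob
  linarith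

/-- The flux equation is the eigenvalue equation integrated once. Dividing by `coeffP`, which is
`C¹` and nonzero on `(0, R]`, shows that `ψ` is `C¹`, so `φ` is `C²` up to `R`. -/
theorem isEigenfunction_of_flux (hd : 1 ≤ d) (hγ : 1 ≤ γ) (hρ : IsLiquidStar d γ R ρ)
    {φ ψ : ℝ → ℝ} (hφ : ∀ y, HasDerivAt φ (ψ y) y) (hψ : Continuous ψ) (hψ0 : ψ 0 = 0)
    (hflux : ∀ y ∈ Icc 0 R, coeffP d γ R ρ y * ψ y
      = ∫ t in (0 : ℝ)..y, (coeffE d γ R ρ t - ν * coeffW d R ρ t) * φ t)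
    (hne : ∃ y ∈ Ioc 0 R, φ y ≠ 0)
    (hrob : coeffP d γ R ρ R * ψ R + d * γ * R ^ d * φ R = 0) :
    IsEigenfunction d γ R ρ ν φ := by
  have hR := hρ.radius_pos
  have hγ0 : γ ≠ 0 := by linarith
  have hpair := (hρ.isSingularPair_coeffE hd hγ).sub_mul (hρ.isSingularPair_coeffW hγ) ν
  have hφc : Continuous φ := continuous_iff_continuousAt.2 fun y => (hφ y).continuousAt
  have hec : Continuous fun t => (coeffE d γ R ρ t - ν * coeffW d R ρ t) * φ t :=
    hpair.continuous_right.mul hφc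
  have hJd : ∀ y, HasDerivAt
      (fun y => ∫ t in (0 : ℝ)..y, (coeffE d γ R ρ t - ν * coeffW d R ρ t) * φ t)
      ((coeffE d γ R ρ y - ν * coeffW d R ρ y) * φ y) y := fun y =>
    (hec.integral_hasStrictDerivAt 0 y).hasDerivAt
  have hder : deriv φ = ψ := funext fun y => (hφ y).deriv
  refine ⟨memH1r_of_hasDerivAt hφ hψ hψ0, hne, ?_, fun y hy => ?_, ?_⟩
  · have hJ1 : ContDiff ℝ 1
        (fun y => ∫ t in (0 : ℝ)..y, (coeffE d γ R ρ t - ν * coeffW d R ρ t) * φ t) :=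
      contDiff_one_iff_deriv.2 ⟨fun y => (hJd y).differentiableAt, by
        rw [funext fun y => (hJd y).deriv]; exact hec⟩
    have hψ1 : ContDiffOn ℝ 1 ψ (Ioc 0 R) := by
      refine (hJ1.contDiffOn.div hρ.contDiffOn_coeffP fun y hy => (hpair.pos hy).ne').congr
        fun y hy => ?_
      simp only [Pi.div_apply]
      rw [← hflux y (Ioc_subset_Icc_self hy), mul_div_cancel_left₀ _ (hpair.pos hy).ne']
    exact contDiffOn_succ_of_hasDerivWithinAt (n := 1) (uniqueDiffOn_Ioc 0 R)
      (fun y _ => (hφ y).hasDerivWithinAt) hψ1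
  · have hyI := Ioo_subset_Icc_self hy
    have h1 : HasDerivAt (fun s => ρ s ^ γ * s ^ (d + 1) * deriv φ s)
        (γ⁻¹ * ((coeffE d γ R ρ y - ν * coeffW d R ρ y) * φ y)) y := by
      refine ((hJd y).const_mul γ⁻¹).congr_of_eventuallyEq ?_
      filter_upwards [isOpen_Ioo.mem_nhds hy] with s hs
      rw [← hflux s (Ioo_subset_Icc_self hs), hder, coeffP,
        clampDensity_of_mem (Ioo_subset_Icc_self hs)]
      field_simp
    rw [L, h1.deriv, (hρ.hasDerivAt_pressure hy).deriv, coeffE, coeffW,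
      ← IsLiquidStar.pow_mul_pressureGrad hd hy.1, clampDensity_of_mem hyI]
    field_simp
    ring
  · rw [Robin, (hφ R).hasDerivWithinAt.derivWithin (uniqueDiffOn_Ioc 0 R R ⟨hR, le_rfl⟩)]
    rw [hρ.coeffP_radius] at hrob
    have h1 : γ * R ^ d * (d * φ R + R * ψ R) = 0 := by
      linear_combination hrob
    exact (mul_eq_zero.1 h1).resolve_left (mul_ne_zero hγ0 (pow_pos hR d).ne')

theorem IsEigenfunction.isLinearisedSolution (hρ : IsLiquidStar d γ R ρ)
    (hχ : IsEigenfunction d γ R ρ ν χ) {lam : ℝ} (hlam : lam ^ 2 = -ν) :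
    IsLinearisedSolution d γ R ρ (fun y t => Real.exp (lam * t) * χ y) := by
  refine ⟨fun t y hy => ?_, fun t => ?_⟩
  · have hyI := Ioo_subset_Icc_self hy
    have hcd : ContDiffOn ℝ 2 χ (Ioo 0 R) := hχ.contDiffOn.mono Ioo_subset_Ioc_self
    have hd1 : ∀ s ∈ Ioo 0 R, HasDerivAt χ (deriv χ s) s := fun s hs =>
      ((hcd.contDiffAt (isOpen_Ioo.mem_nhds hs)).differentiableAt two_ne_zero).hasDerivAt
    have h3 : ContDiffOn ℝ 1 (deriv χ) (Ioo 0 R) :=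
      ((contDiffOn_succ_iff_deriv_of_isOpen isOpen_Ioo (n := 1)).1 hcd).2.2
    have hd2 : HasDerivAt (deriv χ) (deriv (deriv χ) y) y :=
      ((h3.contDiffAt (isOpen_Ioo.mem_nhds hy)).differentiableAt one_ne_zero).hasDerivAt
    have hr := (hρ.differentiableAt y hy).hasDerivAt
    have heqn := hχ.eqn y hy
    have hf := ((hr.mul (hasDerivAt_pow (d + 1) y)).mul hd2)
    have hf' : HasDerivAt (fun s => ρ s ^ γ * s ^ (d + 1) * deriv χ s) _ y := hf
    rw [L, hf'.deriv] at heqn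
    set E := Real.exp (lam * t) with hE
    have hexp : ∀ τ, HasDerivAt (fun τ => Real.exp (lam * τ)) (lam * Real.exp (lam * τ)) τ := by
      intro τ
      simpa [mul_comm] using ((hasDerivAt_id τ).const_mul lam).exp
    have htt : iteratedDeriv 2 (fun τ => Real.exp (lam * τ) * χ y) t = lam ^ 2 * E * χ y := by
      rw [iteratedDeriv_succ, iteratedDeriv_one]
      have e1 : deriv (fun τ => Real.exp (lam * τ) * χ y)
          = fun τ => lam * (Real.exp (lam * τ) * χ y) := funext fun τ => by
        rw [((hexp τ).mul_const (χ y)).deriv]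
        ring
      rw [e1, (((hexp t).mul_const (χ y)).const_mul lam).deriv]
      ring
    have hsp : HasDerivAt (fun s => ρ s ^ γ * (d * (E * χ s) + s * deriv (fun z => E * χ z) s))
        (deriv (fun s => ρ s ^ γ) y * (d * (E * χ y) + y * (E * deriv χ y))
          + ρ y ^ γ * (d * (E * deriv χ y) + (1 * (E * deriv χ y) + y * (E * deriv (deriv χ) y))))
        y := by
      have h4 := hr.mul ((((hd1 y hy).const_mul E).const_mul (d : ℝ)).add
        ((hasDerivAt_id y).mul (hd2.const_mul E)))
      refine h4.congr_of_eventuallyEq ?_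
      filter_upwards [isOpen_Ioo.mem_nhds hy] with s hs
      rw [((hd1 s hs).const_mul E).deriv]
      rfl
    simp only
    rw [htt, hsp.deriv]
    have hρy := (hρ.pos y hyI).ne'
    have hyd : y ^ d ≠ 0 := (pow_pos hy.1 d).ne'
    simp only [Pi.mul_apply, Nat.add_sub_cancel] at heqn
    push_cast at heqn
    -- Multiplied by `ρ y^d`, the linearised equation becomes the eigenvalue equation times `E`.
    have key : ρ y * y ^ d * (y * (lam ^ 2 * E * χ y)
        + 2 * ((d : ℝ) - 1) / ρ y * (E * χ y) * deriv (fun s => ρ s ^ γ) y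
        - γ * (1 / ρ y) * (deriv (fun s => ρ s ^ γ) y * (d * (E * χ y) + y * (E * deriv χ y))
          + ρ y ^ γ * (d * (E * deriv χ y)
            + (1 * (E * deriv χ y) + y * (E * deriv (deriv χ) y))))) = 0 := by
      rw [hlam]
      field_simp
      linear_combination E * heqn
    exact (mul_eq_zero.1 key).resolve_left (mul_ne_zero hρy hyd)
  · have hR := hρ.radius_pos
    have hRm : R ∈ Ioc 0 R := ⟨hR, le_rfl⟩
    have h1 := ((hχ.contDiffOn.differentiableOn two_ne_zero) R hRm).hasDerivWithinAt
    have h2 := hχ.robin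
    rw [Robin] at h2 ⊢
    rw [(h1.const_mul (Real.exp (lam * t))).derivWithin (uniqueDiffOn_Ioc 0 R R hRm)]
    linear_combination Real.exp (lam * t) * h2

/-- Existence of a normalised ground state, minimising the quadratic form. -/
theorem IsLiquidStar.exists_minimiser (hd : 1 ≤ d) (hγ : 1 ≤ γ) (hρ : IsLiquidStar d γ R ρ) :
    ∃ (μ : ℝ) (χs : ℝ → ℝ), IsEigenfunction d γ R ρ μ χs ∧ wNormSq d R ρ χs = 1 ∧
      ∀ χ, MemH1r (d + 2) R χ → μ * wNormSq d R ρ χ ≤ Q d γ R ρ χ χ := by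
  have hR := hρ.radius_pos
  have hE := hρ.isSingularPair_coeffE hd hγ
  have hW := hρ.isSingularPair_coeffW hγ
  obtain ⟨C, hC⟩ := hρ.abs_coeffP_le hγ
  have hγ0 : 0 < γ := by linarith
  -- Since `P(R) = γ R^(d+1)`, this `β` makes the shooting condition the Robin condition times `γ
  -- R^d`; it is also the boundary coefficient in `Q`.
  obtain ⟨μ, φ, ψ, hφ, hpos, hrob⟩ := exists_ground_state hR hE hW hC hρ.lower_coeffW
    (β := d * γ * R ^ d) (by positivity)
  have hRR : R ∈ Icc 0 R := ⟨hR.le, le_rfl⟩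
  have hscale : ∀ c : ℝ, c ≠ 0 → IsEigenfunction d γ R ρ μ (fun y => c * φ y) := by
    intro c hc
    refine isEigenfunction_of_flux hd hγ hρ (ψ := fun y => c * ψ y)
      (fun y => (hφ.hasDerivAt y).const_mul c) (continuous_const.mul hφ.continuous_deriv)
      (by rw [hφ.deriv_zero, mul_zero]) (fun y hy => ?_)
      ⟨R, ⟨hR, le_rfl⟩, mul_ne_zero hc (hpos R hRR).ne'⟩ (by linear_combination c * hrob)
    rw [mul_left_comm, hφ.flux y hy, ← intervalIntegral.integral_const_mul]
    refine intervalIntegral.integral_congr fun t _ => ?_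
    ring
  set N := wNormSq d R ρ φ with hN
  have hNpos : 0 < N := by
    have h1 : IsEigenfunction d γ R ρ μ φ := by simpa using hscale 1 one_ne_zero
    exact hρ.wNormSq_pos hγ (h1.memH1r.isRadialProfile hR) h1.ne_zero
  refine ⟨μ, fun y => (Real.sqrt N)⁻¹ * φ y, hscale _ (by positivity), ?_, fun χ hχ => ?_⟩
  · have h1 : wNormSq d R ρ (fun y => (Real.sqrt N)⁻¹ * φ y) = (Real.sqrt N)⁻¹ ^ 2 * N := by
      rw [hN, wNormSq, wNormSq, ← intervalIntegral.integral_const_mul]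
      refine intervalIntegral.integral_congr fun t _ => ?_
      ring
    rw [h1, inv_pow, Real.sq_sqrt hNpos.le, inv_mul_cancel₀ hNpos.ne']
  · have hprof : IsRadialProfile (d + 1) R χ := hχ.isRadialProfile hR
    have h1 := hφ.picone hR (hE.sub_mul hW μ) hC hpos hprof
    have h2 := hρ.Q_sub_mul_wNormSq hd hγ hprof μ
    have h3 : coeffP d γ R ρ R * ψ R / φ R = -(d * γ * R ^ d) := by
      rw [div_eq_iff (hpos R hRR).ne']
      linarith
    rw [h3] at h1
    linarith

end Star
end LaneEmden

theorem mainTheorem4 (d : ℕ) (hd : 3 ≤ d) (γ : ℝ) (hγ : 1 ≤ γ) (R : ℝ) (ρ : ℝ → ℝ)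
    (hρ : LaneEmden.IsLiquidStar d γ R ρ) :
    ∃ (μ : ℝ) (χs : ℝ → ℝ),
      -- `μ` is the infimum, attained, of `⟨Lχ, χ⟩` over the unit sphere of the weighted norm
      IsLeast {q : ℝ | ∃ χ : ℝ → ℝ, LaneEmden.MemH1r (d + 2) R χ ∧
        LaneEmden.wNorm d R ρ χ = 1 ∧ q = LaneEmden.Q d γ R ρ χ χ} μ ∧
      -- `μ` is the smallest eigenvalue
      IsLeast {ν : ℝ | ∃ χ : ℝ → ℝ, LaneEmden.IsEigenfunction d γ R ρ ν χ} μ ∧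
      -- the infimum is attained at an eigenfunction
      LaneEmden.MemH1r (d + 2) R χs ∧ LaneEmden.wNorm d R ρ χs = 1 ∧
      LaneEmden.Q d γ R ρ χs χs = μ ∧ LaneEmden.IsEigenfunction d γ R ρ μ χs ∧
      -- a negative value of the quadratic form yields a growing mode
      ((∃ χ : ℝ → ℝ, LaneEmden.MemH1r (d + 2) R χ ∧ LaneEmden.Q d γ R ρ χ χ < 0) →
        μ < 0 ∧ LaneEmden.IsGrowingMode d γ R ρ (Real.sqrt (-μ)) χs) := by
  have hd1 : 1 ≤ d := by omega
  have hR := hρ.radius_pos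
  obtain ⟨μ, χs, hs, hs1, hmin⟩ := hρ.exists_minimiser hd1 hγ
  have hnorm : LaneEmden.wNorm d R ρ χs = 1 := by
    rw [LaneEmden.wNorm_eq_sqrt hR.le, hs1, Real.sqrt_one]
  have hQ : LaneEmden.Q d γ R ρ χs χs = μ := by rw [hs.Q_eq hd1 hγ hρ, hs1, mul_one]
  refine ⟨μ, χs, ⟨⟨χs, hs.memH1r, hnorm, hQ.symm⟩, ?_⟩, ⟨⟨χs, hs⟩, ?_⟩, hs.memH1r, hnorm, hQ, hs, ?_⟩
  · rintro q ⟨χ, hχ, h1, rfl⟩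
    rw [LaneEmden.wNorm_eq_sqrt hR.le, Real.sqrt_eq_one] at h1
    simpa [h1] using hmin χ hχ
  · rintro ν ⟨χ, hχ⟩
    have h1 := hmin χ hχ.memH1r
    rw [hχ.Q_eq hd1 hγ hρ] at h1
    exact le_of_mul_le_mul_right h1
      (hρ.wNormSq_pos hγ (hχ.memH1r.isRadialProfile hR) hχ.ne_zero)
  · rintro ⟨χ, hχ, hneg⟩
    -- The inequality `μ ‖χ‖² ≤ ⟨Lχ, χ⟩ < 0` is used directly, so `χ` need not be normalised.
    have hμ : μ < 0 := by
      by_contra hn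
      have := mul_nonneg (not_lt.1 hn) (hρ.wNormSq_nonneg (χ := χ))
      linarith [hmin χ hχ]
    refine ⟨hμ, Real.sqrt_pos.2 (by linarith), hs.memH1r, hs.ne_zero, hs.contDiffOn, ?_⟩
    exact hs.isLinearisedSolution hρ (Real.sq_sqrt (by linarith))
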